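/- For $f:2^U\to\mathbb{Q}_{\ge 0}$ on a finite universe $U=\{0,\dots,n-1\}$, call $f$ submodular if $f(S)+f(T)\ge f(S\cup T)+f(S\cap T)$ for all $S,T\subseteq U$, and let $$F(\bar y)=\sum_{R\subseteq U} f(R)\prod_{i\in R}y_i\prod_{i\in U\setminus R}(1-y_i),\qquad \bar y\in[0,1]^U,$$ be its extension by expectation. Fix $d\ge 1$. An instance consists of $n$, cost vectors $\bar c(i)\in\mathbb{Q}_{\ge0}^d$ ($i\in U$), a budget vector $\bar L\in\mathbb{Q}_{\ge 0}^d$, and a value oracle for $f$. A set $S\subseteq U$ is feasible if $\sum_{i\in S}\bar c(i)\le\bar L$; $\mathcal O$ is the maximum of $f$ over feasible sets; and $P=\{\bar y\in[0,1]^U : \sum_{i\in U}y_i\bar c(i)\le\bar L\}$. Algorithms run in polynomial time if, for all random bits, their running time (in a bit-cost model with access to the value oracle and to independent uniform random bits) is bounded by a polynomial in the length of the binary encoding of $n$, the costs and the budget, plus the maximum length of a value of $f$. Let $\mathcal F$ be any class of non-negative submodular functions (on universes $\{0,\dots,n-1\}$, $n\ge0$) and $\alpha\in(0,1]$. **Theorem.**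 Suppose there is a polynomial-time (possibly randomized) $\alpha$-approximation algorithm for the continuous problem with $d$ knapsack constraints with respect to $\mathcal F$: an algorithm that, for every $f\in\mathcal F$ and all costs and budgets, always outputs a rational point $\bar y\in P$, with $\mathbb E[F(\bar y)]\ge\alpha\,\mathcal O$. Then for every $\varepsilon>0$ there is a polynomial-time randomized $(\alpha-\varepsilon)$-approximation algorithm for maximizing functions of $\mathcal F$ subject to $d$ knapsack constraints: an algorithm that, for every $f\in\mathcal F$ and all costs and budgets, always outputs a feasible set $S$, with $\mathbb E[f(S)]\ge(\alpha-\varepsilon)\,\mathcal O$. (The polynomials and the algorithms may depend on $d$, $\mathcal F$, $\alpha$, and the second ones also on $\varepsilon$.) -/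

import Mathlib

/-! ## Set functions, the multilinear extension and knapsack instances -/

namespace SubKnapsack

/-- `f(S) + f(T) ≥ f(S ∪ T) + f(S ∩ T)` for all `S, T ⊆ U = {0, …, n-1}`. -/
def Submodular {n : ℕ} (f : Finset (Fin n) → ℚ) : Prop :=
  ∀ S T : Finset (Fin n), f (S ∪ T) + f (S ∩ T) ≤ f S + f T

/-- The extension by expectation
`F(y) = ∑_{R ⊆ U} f(R) ∏_{i ∈ R} y_i ∏_{i ∉ R} (1 - y_i)`. -/
def multilinear {n : ℕ} (f : Finset (Fin n) → ℚ) (y : Fin n → ℚ) : ℚ :=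
  ∑ R : Finset (Fin n), f R * ((∏ i ∈ R, y i) * ∏ i ∈ Rᶜ, (1 - y i))

/-- The costs and the budget of an instance with `d` knapsack constraints on the universe
`{0, …, n-1}`: all numbers are non-negative rationals. -/
structure Instance (d n : ℕ) where
  cost : Fin n → Fin d → ℚ
  budget : Fin d → ℚ
  cost_nonneg : ∀ i r, 0 ≤ cost i r
  budget_nonneg : ∀ r, 0 ≤ budget r

/-- `S` is feasible: its total cost is at most the budget in every dimension. -/
def Instance.Feasible {d n : ℕ} (I : Instance d n) (S : Finset (Fin n)) : Prop :=
  ∀ r : Fin d, ∑ i ∈ S, I.cost i r ≤ I.budget r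

instance {d n : ℕ} (I : Instance d n) : DecidablePred I.Feasible := fun S =>
  inferInstanceAs (Decidable (∀ r : Fin d, ∑ i ∈ S, I.cost i r ≤ I.budget r))

/-- `y` lies in the polytope `P = {y ∈ [0,1]^U | ∑ i, y_i c(i) ≤ L}`. -/
def Instance.FracFeasible {d n : ℕ} (I : Instance d n) (y : Fin n → ℚ) : Prop :=
  (∀ i, 0 ≤ y i ∧ y i ≤ 1) ∧ ∀ r : Fin d, ∑ i, y i * I.cost i r ≤ I.budget r

theorem Instance.feasible_empty {d n : ℕ} (I : Instance d n) : I.Feasible ∅ := fun r => by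
  simpa using I.budget_nonneg r

theorem Instance.feasible_nonempty {d n : ℕ} (I : Instance d n) :
    (Finset.univ.filter I.Feasible).Nonempty :=
  ⟨∅, by simp [I.feasible_empty]⟩

/-- The value of an optimal (integral) solution. -/
def Instance.opt {d n : ℕ} (I : Instance d n) (f : Finset (Fin n) → ℚ) : ℚ :=
  (Finset.univ.filter I.Feasible).sup' I.feasible_nonempty f

/-! ## The machine model

Programs of a small first-order language act on binary trees whose leaves are rational numbers.
The running time is a bit cost: a primitive operation is charged the number of bits of its argument
and of its result.  Each of the primitive operations is computed by a Turing machine in time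
polynomial in its charge, and the language simulates Turing machines with polynomial overhead, so
that polynomial time has its usual meaning.  A program can query a value oracle for the set function
and can read the cells of a random tape. -/

/-- Data: binary trees with rational leaves. -/
inductive Data where
  | num (q : ℚ) : Data
  | pair (a b : Data) : Data

namespace Data

/-- The length of a binary encoding, up to a constant factor. -/
def size : Data → ℕ
  | num q => 1 + q.num.natAbs.size + q.den.size
  | pair a b => 1 + a.size + b.size

/-- Left subtree (`0` for a leaf). -/
def fst : Data → Data
  | num _ => num 0
  | pair a _ => a

/-- Right subtree (`0` for a leaf). -/
def snd : Data → Data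
  | num _ => num 0
  | pair _ b => b

/-- The number at a leaf (`0` for a tree that is not a leaf). -/
def val : Data → ℚ
  | num q => q
  | pair _ _ => 0

/-- Lists are nested pairs, ended by the leaf `0`. -/
def ofList : List Data → Data
  | [] => num 0
  | a :: l => pair a (ofList l)

/-- The list that consists of the values of `g` on `0, …, n-1`. -/
def ofFn {n : ℕ} (g : Fin n → Data) : Data := ofList (List.ofFn g)

/-- The entry of a list at position `i`, counted from `0`. -/
def nth : Data → ℕ → Data
  | x, 0 => x.fst
  | x, i + 1 => x.snd.nth i

/-- The vector that a list of numbers describes. -/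
def toVec (n : ℕ) (x : Data) : Fin n → ℚ := fun i => (x.nth i).val

/-- The set that a list of numbers describes: `i` is in it iff entry `i` is not `0`. -/
def toSet (n : ℕ) (x : Data) : Finset (Fin n) := Finset.univ.filter fun i => x.toVec n i ≠ 0

end Data

/-- Primitive operations. -/
inductive Op where
  | id | const (v : Data) | fst | snd | isPair | add | neg | mul | inv | floor | le

/-- The effect of a primitive operation.  Binary operations on numbers act on a pair. -/
def Op.apply : Op → Data → Data
  | .id, x => x
  | .const v, _ => v
  | .fst, x => x.fst
  | .snd, x => x.snd
  | .isPair, .pair _ _ => .num 1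
  | .isPair, .num _ => .num 0
  | .add, x => .num (x.fst.val + x.snd.val)
  | .neg, x => .num (-x.val)
  | .mul, x => .num (x.fst.val * x.snd.val)
  | .inv, x => .num (x.val)⁻¹
  | .floor, x => .num (⌊x.val⌋ : ℤ)
  | .le, x => .num (if x.fst.val ≤ x.snd.val then 1 else 0)

/-- Programs.  `pair p q` maps `x` to `(p x, q x)`, `seq p q` runs `p` and then `q` on its result,
`ite c p q` runs `p` if `c` gives a nonzero number and `q` otherwise, and `loop c p` applies `p`
as long as `c` gives a nonzero number. -/
inductive Prog where
  | op (o : Op)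
  | query
  | coin
  | pair (p q : Prog)
  | seq (p q : Prog)
  | ite (c p q : Prog)
  | loop (c p : Prog)

/-- What a program can access apart from its input: a value oracle and a tape of bits. -/
structure Env where
  value : Data → ℚ
  tape : ℕ → Bool

/-- `Exec E p x y t`: in the environment `E`, the program `p` halts on the input `x` with the
output `y`, in time `t`.  Reading cell `k` of the tape is charged `k` on top of the bits involved;
an oracle query is charged the bits of the query and of the answer. -/
inductive Exec (E : Env) : Prog → Data → Data → ℕ → Prop
  | op (o : Op) (x : Data) :
      Exec E (.op o) x (o.apply x) (1 + x.size + (o.apply x).size)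
  | query (x : Data) :
      Exec E .query x (.num (E.value x)) (1 + x.size + (Data.num (E.value x)).size)
  | coin (x : Data) (k : ℕ) (b : ℚ) (hk : k = ⌊x.val⌋.toNat)
      (hb : b = if E.tape k = true then 1 else 0) :
      Exec E .coin x (.num b) (1 + x.size + k + (Data.num b).size)
  | pair {p q : Prog} {x a b : Data} {s t : ℕ} (hp : Exec E p x a s) (hq : Exec E q x b t) :
      Exec E (.pair p q) x (.pair a b) (1 + s + t)
  | seq {p q : Prog} {x y z : Data} {s t : ℕ} (hp : Exec E p x y s) (hq : Exec E q y z t) :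
      Exec E (.seq p q) x z (1 + s + t)
  | ite_true {c p q : Prog} {x v y : Data} {s t : ℕ} (hc : Exec E c x v s) (hv : v.val ≠ 0)
      (hp : Exec E p x y t) : Exec E (.ite c p q) x y (1 + s + t)
  | ite_false {c p q : Prog} {x v y : Data} {s t : ℕ} (hc : Exec E c x v s) (hv : v.val = 0)
      (hq : Exec E q x y t) : Exec E (.ite c p q) x y (1 + s + t)
  | loop_stop {c p : Prog} {x v : Data} {s : ℕ} (hc : Exec E c x v s) (hv : v.val = 0) :
      Exec E (.loop c p) x x (1 + x.size + s)
  | loop_step {c p : Prog} {x v y z : Data} {s t u : ℕ} (hc : Exec E c x v s) (hv : v.val ≠ 0)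
      (hp : Exec E p x y t) (hl : Exec E (.loop c p) y z u) :
      Exec E (.loop c p) x z (1 + x.size + s + t + u)

/-! ## Randomized polynomial time approximation -/

/-- The environment with a value oracle for `f` and the `m` random bits `ω`.  Cells from `m` on
are `0`; a program that runs for at most `m` steps does not reach them. -/
def env {n m : ℕ} (f : Finset (Fin n) → ℚ) (ω : Fin m → Bool) : Env where
  value x := f (x.toSet n)
  tape k := if h : k < m then ω ⟨k, h⟩ else false

/-- The input of an algorithm: `n`, the budget vector and the cost vectors. -/
def Instance.encode {d n : ℕ} (I : Instance d n) : Data :=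
  .pair (.num n) (.pair (Data.ofFn fun r => .num (I.budget r))
    (Data.ofFn fun i => Data.ofFn fun r => .num (I.cost i r)))

/-- The input size: the length of the encoding of the costs and the budget, plus the
largest length of a value of `f`, that is, of an answer of the oracle. -/
def inputSize {d n : ℕ} (f : Finset (Fin n) → ℚ) (I : Instance d n) : ℕ :=
  I.encode.size + Finset.univ.sup fun S : Finset (Fin n) => (Data.num (f S)).size

/-- `out` gives the output of `A` on the instance `I` with value oracle `f`, as a function of the
`m` random bits, and `A` halts within time `m` whatever these bits are. -/
def RunsWithin {d n : ℕ} (A : Prog) (f : Finset (Fin n) → ℚ) (I : Instance d n) (m : ℕ)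
    (out : (Fin m → Bool) → Data) : Prop :=
  ∀ ω, ∃ t ≤ m, Exec (env f ω) A I.encode (out ω) t

/-- Expectation over `m` independent uniform random bits. -/
def expect {m : ℕ} (g : (Fin m → Bool) → ℚ) : ℚ := (∑ ω, g ω) / 2 ^ m

/-- There is a polynomial time (possibly randomized) `α`-approximation algorithm for the
continuous problem with `d` knapsack constraints with respect to the functions of the class `𝓕`:
with access to a value oracle for `f ∈ 𝓕` it always gives a point `y ∈ P`, and the
(expected) value `F(y)` is at least `α` times the value of an optimal integral solution. -/
def HasContinuousApprox (d : ℕ) (𝓕 : (n : ℕ) → Set (Finset (Fin n) → ℚ)) (α : ℝ) : Prop :=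
  ∃ (A : Prog) (p : Polynomial ℕ), ∀ (n : ℕ), ∀ f ∈ 𝓕 n, ∀ I : Instance d n,
    ∃ out : (Fin (p.eval (inputSize f I)) → Bool) → Data,
      RunsWithin A f I (p.eval (inputSize f I)) out ∧
      (∀ ω, I.FracFeasible ((out ω).toVec n)) ∧
      α * (I.opt f : ℝ) ≤ (expect fun ω => multilinear f ((out ω).toVec n) : ℚ)

/-- There is a polynomial time randomized `β`-approximation algorithm for maximizing functions
of the class `𝓕` subject to `d` knapsack constraints: with access to a value oracle for `f ∈ 𝓕`
it always gives a feasible set, whose expected value is at least `β` times the optimum. -/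
def HasDiscreteApprox (d : ℕ) (𝓕 : (n : ℕ) → Set (Finset (Fin n) → ℚ)) (β : ℝ) : Prop :=
  ∃ (B : Prog) (p : Polynomial ℕ), ∀ (n : ℕ), ∀ f ∈ 𝓕 n, ∀ I : Instance d n,
    ∃ out : (Fin (p.eval (inputSize f I)) → Bool) → Data,
      RunsWithin B f I (p.eval (inputSize f I)) out ∧
      (∀ ω, I.Feasible ((out ω).toSet n)) ∧
      β * (I.opt f : ℝ) ≤ (expect fun ω => f ((out ω).toSet n) : ℚ)

end SubKnapsack

/-!
The algorithm guesses a set `T` of boundedly many elements of an optimal set, and, for each guess,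
solves the continuous problem on the residual instance, in which the elements of `T` are free and
the budget is what is left after buying `T`.  It scales the fractional solution down by `1 - 1 / N`,
chooses the elements independently with the resulting probabilities, and gives up on the guess if
the chosen set is not feasible.  The best set found is the output.  It is at least as good as the
set found for any fixed guess, so that independence is only needed within a guess.

Some guess is good (`Instance.exists_light`).  Let `T` be a largest subset of an optimal set among
those with a value of at least about `|T|` times a small fraction of the optimum.  Then each further
element of the optimal set has a small marginal value.  In each dimension only boundedly many of
them cost more than a fraction `1 / D` of the remaining budget, so that those can be dropped: all
others are light.

The algorithm for the continuous problem works for the functions of the class only, so that it can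
be applied neither to the contraction of `f` by `T` nor to the restriction of `f` to light elements.
Making the elements of `T` free replaces the first: every fractional solution is acceptable if its
value is large.  The second is replaced by penalties: the cost of the elements that are not light is
raised so much that they contribute next to nothing (`Instance.FracFeasible.mul_le`).

The rounding loses little (`Instance.le_multilinear_repair_roundProb`).  The extension by
expectation is concave along rays from the origin, which bounds the loss by scaling.  The costs of
the random set have a small variance, since all elements are light, and a mean of at most
`1 - 1 / N` times the budget.  A set of light elements splits into feasible sets whose number is
linear in its cost, so that its value is at most linear in its cost; hence the value lost with the
infeasible sets is at most a multiple of the sum of the squared deviations of the costs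
(`Instance.le_multilinear_repair`).

Each random choice is made by comparing `n + N` random bits with a threshold, and the algorithm for
the continuous problem is made to read only the even positions of the tape, so that its bits are
independent of those of the rounding (`le_expect_guess`).

Polynomial running times are established by a calculus of expressions (`Machine.Comp`): it is closed
under composition, arithmetic, case distinctions, bounded loops, sums and tabulation, and the
algorithm is an expression of this kind (`comp_search`).
-/

namespace SubKnapsack

/-! ### Sizes of numbers and of data -/

theorem size_mul_le (a b : ℕ) : (a * b).size ≤ a.size + b.size := by
  rw [Nat.size_le, pow_add]
  exact Nat.mul_lt_mul'' a.lt_size_self b.lt_size_self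

theorem size_add_le (a b : ℕ) : (a + b).size ≤ max a.size b.size + 1 := by
  rw [Nat.size_le, pow_succ]
  have ha := a.lt_size_self.trans_le
    (Nat.pow_le_pow_right two_pos (le_max_left a.size b.size))
  have hb := b.lt_size_self.trans_le
    (Nat.pow_le_pow_right two_pos (le_max_right a.size b.size))
  omega

theorem size_den_add_le (a b : ℚ) : (a + b).den.size ≤ a.den.size + b.den.size :=
  (Nat.size_le_size (Nat.le_of_dvd (Nat.mul_pos a.den_pos b.den_pos)
    (Rat.add_den_dvd a b))).trans (size_mul_le _ _)

theorem size_num_add_le (a b : ℚ) : (a + b).num.natAbs.size ≤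
    max (a.num.natAbs.size + b.den.size) (b.num.natAbs.size + a.den.size) + 1 := by
  have hD := Nat.le_of_dvd (Nat.mul_pos a.den_pos b.den_pos) (Rat.add_den_dvd a b)
  have h := congrArg Int.natAbs (Rat.add_num_den' a b)
  simp only [Int.natAbs_mul, Int.natAbs_natCast] at h
  have h1 : (a + b).num.natAbs ≤ (a.num * b.den + b.num * a.den).natAbs := by
    refine Nat.le_of_mul_le_mul_right ?_ (Nat.mul_pos a.den_pos b.den_pos)
    rw [← mul_assoc, h]
    exact Nat.mul_le_mul_left _ hD
  have h2 : (a.num * b.den + b.num * a.den).natAbs ≤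
      a.num.natAbs * b.den + b.num.natAbs * a.den := by
    refine (Int.natAbs_add_le _ _).trans ?_
    simp [Int.natAbs_mul]
  refine (Nat.size_le_size (h1.trans h2)).trans ((size_add_le _ _).trans ?_)
  have := size_mul_le a.num.natAbs b.den
  have := size_mul_le b.num.natAbs a.den
  omega

theorem Data.size_pos (x : Data) : 0 < x.size := by cases x <;> simp [Data.size]

theorem Data.size_add_le (a b : ℚ) :
    (num (a + b)).size ≤ 2 * (num a).size + 2 * (num b).size := by
  have := size_num_add_le a b
  have := size_den_add_le a b
  simp only [Data.size]
  omega

theorem Data.size_mul_le (a b : ℚ) : (num (a * b)).size ≤ (num a).size + (num b).size := by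
  have h1 : (a * b).num.natAbs.size ≤ a.num.natAbs.size + b.num.natAbs.size := by
    refine le_trans (Nat.size_le_size ?_) (SubKnapsack.size_mul_le _ _)
    rw [Rat.mul_num, ← Int.natAbs_mul]
    exact Int.natAbs_ediv_le_natAbs _ _
  have h2 : (a * b).den.size ≤ a.den.size + b.den.size :=
    (Nat.size_le_size (Nat.le_of_dvd (Nat.mul_pos a.den_pos b.den_pos)
      (Rat.mul_den_dvd a b))).trans (SubKnapsack.size_mul_le _ _)
  simp only [Data.size]
  omega

theorem Data.size_neg (a : ℚ) : (num (-a)).size = (num a).size := by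
  simp [Data.size]

theorem Data.size_inv_le (a : ℚ) : (num a⁻¹).size ≤ (num a).size + 1 := by
  rcases eq_or_ne a 0 with rfl | h
  · simp
  · have h1 : a.num ≠ 0 := by simpa using h
    have h2 : a.num.sign.natAbs = 1 := Int.natAbs_sign_of_ne_zero h1
    simp only [Data.size, Rat.num_inv, Rat.den_inv, if_neg h1, Int.natAbs_mul, h2]
    simp
    omega

theorem Data.size_floor_le (a : ℚ) : (num (⌊a⌋ : ℤ)).size ≤ (num a).size + 1 := by
  have h : ⌊a⌋.natAbs ≤ a.num.natAbs := by
    change a.floor.natAbs ≤ _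
    rw [Rat.floor_def]
    exact Int.natAbs_ediv_le_natAbs _ _
  have := Nat.size_le_size h
  simp [Data.size]
  omega

theorem Data.size_val_le (x : Data) : (num x.val).size ≤ x.size + 1 := by
  cases x with
  | num q => simp [Data.val]
  | pair a b =>
    have := a.size_pos
    simp [Data.val, Data.size]
    omega

theorem Data.size_fst_le (x : Data) : x.fst.size ≤ x.size + 1 := by
  cases x <;> simp [Data.fst, Data.size] <;> omega

theorem Data.size_snd_le (x : Data) : x.snd.size ≤ x.size + 1 := by
  cases x <;> simp [Data.snd, Data.size] <;> omega

theorem Data.size_fst_add_snd_le (x : Data) : x.fst.size + x.snd.size ≤ x.size + 4 := by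
  cases x
  · simp [Data.fst, Data.snd, Data.size]
  · simp [Data.fst, Data.snd, Data.size]
    omega

/-- The result of a primitive operation is at most linearly longer than its argument. -/
theorem Op.exists_size_apply_le (o : Op) : ∃ C, ∀ x, (o.apply x).size ≤ 2 * x.size + C := by
  have key : ∀ x : Data, (Data.num x.fst.val).size + (Data.num x.snd.val).size ≤ x.size + 6 := by
    intro x
    have := x.size_fst_add_snd_le
    have := x.fst.size_val_le
    have := x.snd.size_val_le
    omega
  cases o with
  | id => exact ⟨0, fun x => by simp only [Op.apply]; omega⟩
  | const v => exact ⟨v.size, fun x => by simp [Op.apply]⟩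
  | fst => exact ⟨1, fun x => by have := x.size_fst_le; simp [Op.apply]; omega⟩
  | snd => exact ⟨1, fun x => by have := x.size_snd_le; simp [Op.apply]; omega⟩
  | isPair => exact ⟨3, fun x => by cases x <;> simp [Op.apply, Data.size]⟩
  | add => exact ⟨12, fun x => by
      have := key x
      have := Data.size_add_le x.fst.val x.snd.val
      simp only [Op.apply]; omega⟩
  | neg => exact ⟨1, fun x => by
      have := x.size_val_le
      simp only [Op.apply, Data.size_neg]; omega⟩
  | mul => exact ⟨6, fun x => by
      have := key x
      have := Data.size_mul_le x.fst.val x.snd.val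
      simp only [Op.apply]; omega⟩
  | inv => exact ⟨2, fun x => by
      have := x.size_val_le
      have := Data.size_inv_le x.val
      simp only [Op.apply]; omega⟩
  | floor => exact ⟨2, fun x => by
      have := x.size_val_le
      have := Data.size_floor_le x.val
      simp only [Op.apply]; omega⟩
  | le => exact ⟨3, fun x => by
      simp only [Op.apply]; split_ifs <;> simp [Data.size]⟩

/-- Adding many rationals makes their length grow only linearly: the denominators multiply, and the
numerator of the sum is bounded along with them. -/
theorem Data.size_sum_le {ι : Type*} (s : Finset ι) (q : ι → ℚ) :
    (num (∑ i ∈ s, q i)).size ≤ 2 + 3 * ∑ i ∈ s, (num (q i)).size := by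
  classical
  have h : (∑ i ∈ s, q i).den.size ≤ 1 + ∑ i ∈ s, (q i).den.size ∧
      (∑ i ∈ s, q i).num.natAbs.size ≤
        ∑ i ∈ s, ((q i).num.natAbs.size + (q i).den.size + 2) := by
    induction s using Finset.induction_on with
    | empty => simp
    | insert a s ha ih =>
      rw [Finset.sum_insert ha, Finset.sum_insert ha, Finset.sum_insert ha]
      have h1 := size_den_add_le (q a) (∑ i ∈ s, q i)
      have h2 := size_num_add_le (q a) (∑ i ∈ s, q i)
      have h3 : ∑ i ∈ s, (q i).den.size ≤
          ∑ i ∈ s, ((q i).num.natAbs.size + (q i).den.size + 2) :=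
        Finset.sum_le_sum fun i _ => by omega
      omega
  have h4 : ∑ i ∈ s, (q i).den.size + ∑ i ∈ s, ((q i).num.natAbs.size + (q i).den.size + 2) ≤
      3 * ∑ i ∈ s, (num (q i)).size := by
    rw [← Finset.sum_add_distrib, Finset.mul_sum]
    refine Finset.sum_le_sum fun i _ => ?_
    simp only [Data.size]
    omega
  rw [Data.size]
  omega

theorem Data.size_num_bool_le (b : Bool) : (num (if b = true then 1 else 0)).size ≤ 3 := by
  cases b <;> simp [Data.size]

theorem Data.size_natCast (n : ℕ) : (num (n : ℚ)).size = 2 + n.size := by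
  simp [Data.size]
  omega

theorem Data.size_ofList_le (l : List Data) (B : ℕ) (h : ∀ x ∈ l, x.size ≤ B) :
    (ofList l).size ≤ 2 + l.length * (1 + B) := by
  induction l with
  | nil => simp [ofList, Data.size]
  | cons a l ih =>
    have h1 := h a (by simp)
    have h2 := ih fun x hx => h x (by simp [hx])
    simp only [ofList, Data.size, List.length_cons, add_mul, one_mul]
    omega

theorem Data.length_le_size_ofList (l : List Data) : l.length ≤ (ofList l).size := by
  induction l with
  | nil => simp
  | cons a l ih => simp only [ofList, Data.size, List.length_cons]; omega

theorem Data.nth_ofList (l : List Data) (i : ℕ) (h : i < l.length) :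
    (ofList l).nth i = l[i] := by
  induction l generalizing i with
  | nil => simp at h
  | cons a l ih =>
    cases i with
    | zero => rfl
    | succ i => simpa [ofList, nth, snd] using ih i (by simpa using h)

@[simp] theorem Data.nth_ofFn {n : ℕ} (g : Fin n → Data) (i : Fin n) :
    (ofFn g).nth i = g i := by
  rw [ofFn, nth_ofList _ _ (by simp)]
  simp

theorem Data.nth_eq_fst_iterate (x : Data) (i : ℕ) : x.nth i = (snd^[i] x).fst := by
  induction i generalizing x with
  | zero => rfl
  | succ i ih => simpa [nth] using ih x.snd

/-- The list of the indicator values of a set. -/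
def Data.ofSet {n : ℕ} (S : Finset (Fin n)) : Data :=
  ofFn fun i => num (if i ∈ S then 1 else 0)

@[simp] theorem Data.toSet_ofSet {n : ℕ} (S : Finset (Fin n)) : (ofSet S).toSet n = S := by
  ext i
  simp [toSet, toVec, ofSet, val]

theorem Data.size_ofSet_le {n : ℕ} (S : Finset (Fin n)) : (ofSet S).size ≤ 2 + n * 4 := by
  have := size_ofList_le (List.ofFn fun i => num (if i ∈ S then 1 else 0)) 3 (by
    intro x hx
    obtain ⟨i, rfl⟩ := (List.mem_ofFn' _ _).1 hx
    dsimp only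
    split_ifs <;> simp [Data.size])
  simpa [ofSet, ofFn] using this

/-! ### General facts about executions -/

theorem Exec.size_le {E : Env} {p : Prog} {x y : Data} {t : ℕ} (h : Exec E p x y t) :
    x.size ≤ t ∧ y.size ≤ t := by
  induction h with
  | op => omega
  | query => omega
  | coin => omega
  | pair _ _ ih1 ih2 => simp only [Data.size]; omega
  | seq _ _ ih1 ih2 => omega
  | ite_true _ _ _ ih1 ih2 => omega
  | ite_false _ _ _ ih1 ih2 => omega
  | loop_stop _ _ ih => omega
  | loop_step _ _ _ _ ih1 ih2 ih3 => omega

/-- A computation of length `t` reads only the first `t` cells of the tape. -/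
theorem Exec.congr_tape {E E' : Env} (hv : E.value = E'.value) {p : Prog} {x y : Data} {t : ℕ}
    (h : Exec E p x y t) (ht : ∀ k < t, E.tape k = E'.tape k) : Exec E' p x y t := by
  induction h with
  | op o x => exact .op o x
  | query x => rw [hv]; exact .query x
  | coin x k b hk hb =>
    exact .coin x k b hk (by rw [hb, ht k (by have := x.size_pos; omega)])
  | pair _ _ ih1 ih2 =>
    exact .pair (ih1 fun k hk => ht k (by omega)) (ih2 fun k hk => ht k (by omega))
  | seq _ _ ih1 ih2 =>
    exact .seq (ih1 fun k hk => ht k (by omega)) (ih2 fun k hk => ht k (by omega))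
  | ite_true _ hn _ ih1 ih2 =>
    exact .ite_true (ih1 fun k hk => ht k (by omega)) hn (ih2 fun k hk => ht k (by omega))
  | ite_false _ hn _ ih1 ih2 =>
    exact .ite_false (ih1 fun k hk => ht k (by omega)) hn (ih2 fun k hk => ht k (by omega))
  | loop_stop _ hn ih => exact Exec.loop_stop (ih fun k hk => ht k (by omega)) hn
  | loop_step _ hn _ _ ih1 ih2 ih3 =>
    exact .loop_step (ih1 fun k hk => ht k (by omega)) hn (ih2 fun k hk => ht k (by omega))
      (ih3 fun k hk => ht k (by omega))

/-- The program that reads cell `2 * k` of the tape wherever `p` reads cell `k`. -/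
def Prog.useEven : Prog → Prog
  | .op o => .op o
  | .query => .query
  | .coin => .seq (.seq (.pair (.op .floor) (.op .floor)) (.op .add)) .coin
  | .pair p q => .pair p.useEven q.useEven
  | .seq p q => .seq p.useEven q.useEven
  | .ite c p q => .ite c.useEven p.useEven q.useEven
  | .loop c p => .loop c.useEven p.useEven

/-- Reading only the even positions slows a program down by a constant factor. -/
theorem Exec.useEven {E E' : Env} (hv : E.value = E'.value)
    (hT : ∀ k, E.tape k = E'.tape (2 * k)) {p : Prog} {x y : Data} {t : ℕ}
    (h : Exec E p x y t) : ∃ t' ≤ 40 * t, Exec E' p.useEven x y t' := by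
  induction h with
  | op o x => exact ⟨_, by omega, .op o x⟩
  | query x => rw [hv]; exact ⟨_, by omega, .query x⟩
  | coin x k b hk hb =>
    have h1 : (Data.num (⌊x.val⌋ : ℤ)).size ≤ x.size + 2 :=
      (Data.size_floor_le _).trans (by have := x.size_val_le; omega)
    have h2 := Data.size_add_le (⌊x.val⌋ : ℤ) (⌊x.val⌋ : ℤ)
    have h3 := x.size_pos
    refine ⟨_, ?_, .seq (.seq (.pair (.op .floor x) (.op .floor x)) (.op .add _))
      (.coin _ (2 * k) b ?_ ?_)⟩
    · simp only [Op.apply, Data.fst, Data.snd, Data.val, Data.size] at *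
      omega
    · rw [hk]
      simp only [Op.apply, Data.fst, Data.snd, Data.val]
      rw [← Int.cast_add, Int.floor_intCast]
      omega
    · rw [hb, hT]
  | pair _ _ ih1 ih2 =>
    obtain ⟨t1, h1, e1⟩ := ih1
    obtain ⟨t2, h2, e2⟩ := ih2
    exact ⟨_, by omega, .pair e1 e2⟩
  | seq _ _ ih1 ih2 =>
    obtain ⟨t1, h1, e1⟩ := ih1
    obtain ⟨t2, h2, e2⟩ := ih2
    exact ⟨_, by omega, .seq e1 e2⟩
  | ite_true _ hn _ ih1 ih2 =>
    obtain ⟨t1, h1, e1⟩ := ih1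
    obtain ⟨t2, h2, e2⟩ := ih2
    exact ⟨_, by omega, .ite_true e1 hn e2⟩
  | ite_false _ hn _ ih1 ih2 =>
    obtain ⟨t1, h1, e1⟩ := ih1
    obtain ⟨t2, h2, e2⟩ := ih2
    exact ⟨_, by omega, .ite_false e1 hn e2⟩
  | loop_stop _ hn ih =>
    obtain ⟨t1, h1, e1⟩ := ih
    exact ⟨_, by omega, Exec.loop_stop e1 hn⟩
  | loop_step _ hn _ _ ih1 ih2 ih3 =>
    obtain ⟨t1, h1, e1⟩ := ih1
    obtain ⟨t2, h2, e2⟩ := ih2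
    obtain ⟨t3, h3, e3⟩ := ih3
    exact ⟨_, by omega, .loop_step e1 hn e2 e3⟩

/-- A loop that goes through the states `σ 0, …, σ N` and stops there. -/
theorem Exec.exists_loop {E : Env} {c p : Prog} {N T : ℕ} {σ : ℕ → Data}
    (hc : ∀ j < N, ∃ v, v.val ≠ 0 ∧ ∃ t ≤ T, Exec E c (σ j) v t)
    (hN : ∃ v, v.val = 0 ∧ ∃ t ≤ T, Exec E c (σ N) v t)
    (hp : ∀ j < N, ∃ t ≤ T, Exec E p (σ j) (σ (j + 1)) t) :
    ∃ t ≤ (N + 1) * (1 + 3 * T), Exec E (.loop c p) (σ 0) (σ N) t := by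
  suffices H : ∀ i ≤ N, ∃ t ≤ (i + 1) * (1 + 3 * T),
      Exec E (.loop c p) (σ (N - i)) (σ N) t by
    simpa using H N le_rfl
  intro i
  induction i with
  | zero =>
    intro _
    obtain ⟨v, hv, t, ht, e⟩ := hN
    have := e.size_le
    refine ⟨1 + (σ N).size + t, ?_, Exec.loop_stop e hv⟩
    omega
  | succ i ih =>
    intro hi
    obtain ⟨t, ht, e⟩ := ih (by omega)
    obtain ⟨v, hv, t1, ht1, e1⟩ := hc (N - (i + 1)) (by omega)
    obtain ⟨t2, ht2, e2⟩ := hp (N - (i + 1)) (by omega)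
    rw [show N - (i + 1) + 1 = N - i by omega] at e2
    have := e1.size_le
    refine ⟨_, ?_, .loop_step e1 hv e2 e⟩
    rw [add_mul (i + 1)]
    omega

/-! ### A calculus of polynomial time computations -/

/-- A family of situations `k : K` in which programs run: each has an environment and a size, in
terms of which running times are measured. -/
structure Machine (K : Type*) where
  env : K → Env
  size : K → ℕ

namespace Machine

variable {K K' : Type*} {M : Machine K}

/-- The machine whose situations are obtained from those of `M` by adding data, such as the value
of a loop counter, that does not count towards the size. -/
def pull (M : Machine K) (φ : K' → K) : Machine K' := ⟨M.env ∘ φ, M.size ∘ φ⟩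

/-- The situations of `M` with an index `i < N k`. -/
abbrev idx (M : Machine K) (N : K → ℕ) : Machine (Σ k, Fin (N k)) := M.pull Sigma.fst

/-- `u k` is bounded by a polynomial in the size of `k`. -/
def PolyBdd (M : Machine K) (u : K → ℕ) : Prop :=
  ∃ p : Polynomial ℕ, ∀ k, u k ≤ p.eval (M.size k)

/-- A single program transforms `a k` into `b k` in every situation `k`, in time polynomial in the
size of `k`.  The datum `a k` serves as the context of the computation, the list of the values of
the variables in scope; `b` is then an expression in these variables. -/
def Comp (M : Machine K) (a b : K → Data) : Prop :=
  ∃ (P : Prog) (p : Polynomial ℕ), ∀ k, ∃ t ≤ p.eval (M.size k), Exec (M.env k) P (a k) (b k) t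

/-- Polynomial time computation of a number. -/
abbrev CompQ (M : Machine K) (a : K → Data) (q : K → ℚ) : Prop := M.Comp a fun k => .num (q k)

open Classical in
/-- The number `1` for a true proposition, `0` for a false one. -/
noncomputable def truth (c : Prop) : ℚ := if c then 1 else 0

theorem truth_of {c : Prop} (h : c) : truth c = 1 := if_pos h

theorem truth_not {c : Prop} (h : ¬c) : truth c = 0 := if_neg h

theorem truth_nonneg (c : Prop) : 0 ≤ truth c := by unfold truth; split_ifs <;> norm_num

theorem ite_eq_truth (c : Prop) [Decidable c] : (if c then (1 : ℚ) else 0) = truth c := by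
  by_cases h : c <;> simp [truth, h]

/-- Polynomial time decision of a proposition. -/
abbrev CompB (M : Machine K) (a : K → Data) (c : K → Prop) : Prop := M.CompQ a fun k => truth (c k)

/-! #### Polynomial bounds -/

theorem eval_mono (p : Polynomial ℕ) : Monotone fun x => p.eval x := by
  intro x y h
  dsimp only
  induction p using Polynomial.induction_on' with
  | add p q hp hq => simpa using Nat.add_le_add hp hq
  | monomial n c => simpa using Nat.mul_le_mul_left c (Nat.pow_le_pow_left h n)

namespace PolyBdd

variable {u v : K → ℕ}

theorem of_le (hv : M.PolyBdd v) (h : ∀ k, u k ≤ v k) : M.PolyBdd u :=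
  let ⟨p, hp⟩ := hv
  ⟨p, fun k => (h k).trans (hp k)⟩

theorem size : M.PolyBdd M.size := ⟨.X, fun k => by simp⟩

theorem const (c : ℕ) : M.PolyBdd fun _ => c := ⟨.C c, fun k => by simp⟩

theorem add (hu : M.PolyBdd u) (hv : M.PolyBdd v) : M.PolyBdd fun k => u k + v k :=
  let ⟨p, hp⟩ := hu
  let ⟨q, hq⟩ := hv
  ⟨p + q, fun k => by simpa using Nat.add_le_add (hp k) (hq k)⟩

theorem mul (hu : M.PolyBdd u) (hv : M.PolyBdd v) : M.PolyBdd fun k => u k * v k :=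
  let ⟨p, hp⟩ := hu
  let ⟨q, hq⟩ := hv
  ⟨p * q, fun k => by simpa using Nat.mul_le_mul (hp k) (hq k)⟩

theorem eval (p : Polynomial ℕ) (hu : M.PolyBdd u) : M.PolyBdd fun k => p.eval (u k) :=
  let ⟨q, hq⟩ := hu
  ⟨p.comp q, fun k => by simpa using eval_mono p (hq k)⟩

theorem pull (hu : M.PolyBdd u) (φ : K' → K) : (M.pull φ).PolyBdd (u ∘ φ) :=
  let ⟨p, hp⟩ := hu
  ⟨p, fun k => hp (φ k)⟩

/-- A bound on an indexed quantity is uniform in the index. -/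
theorem exists_unif {N : K → ℕ} {u : (Σ k, Fin (N k)) → ℕ} (hu : (M.idx N).PolyBdd u) :
    ∃ v : K → ℕ, M.PolyBdd v ∧ ∀ k i, u ⟨k, i⟩ ≤ v k :=
  let ⟨p, hp⟩ := hu
  ⟨fun k => p.eval (M.size k), ⟨p, fun _ => le_rfl⟩, fun k i => hp ⟨k, i⟩⟩

end PolyBdd

/-! #### Composition and primitive operations -/

namespace Comp

variable {a b c : K → Data} {q r : K → ℚ}

theorem of_exec {u : K → ℕ} (P : Prog) (hu : M.PolyBdd u)
    (h : ∀ k, ∃ t ≤ u k, Exec (M.env k) P (a k) (b k) t) : M.Comp a b :=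
  let ⟨p, hp⟩ := hu
  ⟨P, p, fun k => let ⟨t, ht, e⟩ := h k; ⟨t, ht.trans (hp k), e⟩⟩

theorem exists_exec (h : M.Comp a b) :
    ∃ (P : Prog) (u : K → ℕ), M.PolyBdd u ∧ ∀ k, ∃ t ≤ u k, Exec (M.env k) P (a k) (b k) t :=
  let ⟨P, p, h⟩ := h
  ⟨P, fun k => p.eval (M.size k), ⟨p, fun _ => le_rfl⟩, h⟩

theorem polyBdd_in (h : M.Comp a b) : M.PolyBdd fun k => (a k).size :=
  let ⟨_, p, h⟩ := h
  ⟨p, fun k => let ⟨_, ht, e⟩ := h k; e.size_le.1.trans ht⟩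

theorem polyBdd_out (h : M.Comp a b) : M.PolyBdd fun k => (b k).size :=
  let ⟨_, p, h⟩ := h
  ⟨p, fun k => let ⟨_, ht, e⟩ := h k; e.size_le.2.trans ht⟩

theorem pull (h : M.Comp a b) (φ : K' → K) : (M.pull φ).Comp (a ∘ φ) (b ∘ φ) :=
  let ⟨P, p, h⟩ := h
  ⟨P, p, fun k => h (φ k)⟩

theorem congr (h : M.Comp a b) (hbc : ∀ k, b k = c k) : M.Comp a c := funext hbc ▸ h

theorem congrQ (hq : M.CompQ a q) (h : ∀ k, q k = r k) : M.CompQ a r := funext h ▸ hq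

theorem trans (hab : M.Comp a b) (hbc : M.Comp b c) : M.Comp a c := by
  obtain ⟨P, u, hu, hP⟩ := hab.exists_exec
  obtain ⟨Q, v, hv, hQ⟩ := hbc.exists_exec
  refine of_exec (.seq P Q) (((PolyBdd.const 1).add hu).add hv) fun k => ?_
  obtain ⟨s, hs, e⟩ := hP k
  obtain ⟨t, ht, e'⟩ := hQ k
  exact ⟨_, by omega, .seq e e'⟩

theorem pair (hb : M.Comp a b) (hc : M.Comp a c) : M.Comp a fun k => .pair (b k) (c k) := by
  obtain ⟨P, u, hu, hP⟩ := hb.exists_exec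
  obtain ⟨Q, v, hv, hQ⟩ := hc.exists_exec
  refine of_exec (.pair P Q) (((PolyBdd.const 1).add hu).add hv) fun k => ?_
  obtain ⟨s, hs, e⟩ := hP k
  obtain ⟨t, ht, e'⟩ := hQ k
  exact ⟨_, by omega, .pair e e'⟩

theorem op (o : Op) (ha : M.PolyBdd fun k => (a k).size) : M.Comp a fun k => o.apply (a k) := by
  obtain ⟨C, hC⟩ := o.exists_size_apply_le
  refine of_exec (.op o) ((ha.mul (.const 3)).add (.const (C + 1)))
    fun k => ⟨_, ?_, .op o (a k)⟩
  have := hC (a k)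
  omega

theorem apply (o : Op) (hb : M.Comp a b) : M.Comp a fun k => o.apply (b k) :=
  hb.trans (op o hb.polyBdd_out)

theorem refl (ha : M.PolyBdd fun k => (a k).size) : M.Comp a a := op .id ha

theorem const (ha : M.PolyBdd fun k => (a k).size) (x : Data) : M.Comp a fun _ => x :=
  op (.const x) ha

theorem fst (hb : M.Comp a b) : M.Comp a fun k => (b k).fst := hb.apply .fst

theorem snd (hb : M.Comp a b) : M.Comp a fun k => (b k).snd := hb.apply .snd

theorem add (hq : M.CompQ a q) (hr : M.CompQ a r) : M.CompQ a fun k => q k + r k :=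
  (hq.pair hr).apply .add

theorem mul (hq : M.CompQ a q) (hr : M.CompQ a r) : M.CompQ a fun k => q k * r k :=
  (hq.pair hr).apply .mul

theorem neg (hq : M.CompQ a q) : M.CompQ a fun k => -q k := apply .neg hq

theorem sub (hq : M.CompQ a q) (hr : M.CompQ a r) : M.CompQ a fun k => q k - r k :=
  congrQ (hq.add hr.neg) fun k => by rw [sub_eq_add_neg]

theorem inv (hq : M.CompQ a q) : M.CompQ a fun k => (q k)⁻¹ := apply .inv hq

theorem div (hq : M.CompQ a q) (hr : M.CompQ a r) : M.CompQ a fun k => q k / r k :=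
  congrQ (hq.mul hr.inv) fun k => by rw [div_eq_mul_inv]

theorem val (hb : M.Comp a b) : M.CompQ a fun k => (b k).val :=
  ((hb.pair (const hb.polyBdd_in (.num 0))).apply .add).congr fun k => by
    simp [Op.apply, Data.fst, Data.snd, Data.val]

theorem le (hq : M.CompQ a q) (hr : M.CompQ a r) : M.CompB a fun k => q k ≤ r k :=
  ((hq.pair hr).apply .le).congr fun k => by
    beta_reduce
    rw [← ite_eq_truth]
    rfl

/-- An oracle query; the bound on the length of the answer is a hypothesis on the machine. -/
theorem query (hb : M.Comp a b)
    (hv : M.PolyBdd fun k => (Data.num ((M.env k).value (b k))).size) :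
    M.CompQ a fun k => (M.env k).value (b k) :=
  hb.trans <| of_exec .query (((PolyBdd.const 1).add hb.polyBdd_out).add hv)
    fun k => ⟨_, le_rfl, .query (b k)⟩

/-- As reading cell `i k` is charged `i k`, the position has to be polynomially bounded, and not
only its length. -/
theorem coin {i : K → ℕ} (hi : M.CompQ a fun k => (i k : ℚ)) (hb : M.PolyBdd i) :
    M.CompQ a fun k => if (M.env k).tape (i k) = true then 1 else 0 :=
  trans hi <| of_exec .coin ((((PolyBdd.const 1).add hi.polyBdd_out).add hb).add (.const 3))
    fun k => ⟨_, Nat.add_le_add_left (Data.size_num_bool_le _) _, .coin _ (i k) _ (by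
      simp [Data.val]) rfl⟩

/-- Case distinction.  Each branch only has to work in the situations that lead to it. -/
theorem cases {p : K → Prop} (hp : M.CompB a p)
    (hb : (M.pull (Subtype.val : {k // p k} → K)).Comp (a ∘ Subtype.val) (b ∘ Subtype.val))
    (hb' : (M.pull (Subtype.val : {k // ¬p k} → K)).Comp (a ∘ Subtype.val) (b ∘ Subtype.val)) :
    M.Comp a b := by
  obtain ⟨C, u, hu, hC⟩ := hp.exists_exec
  obtain ⟨P, pP, hP⟩ := hb
  obtain ⟨Q, pQ, hQ⟩ := hb'
  refine of_exec (.ite C P Q) (((PolyBdd.const 1).add hu).add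
    ((PolyBdd.size.eval pP).add (PolyBdd.size.eval pQ))) fun k => ?_
  obtain ⟨s, hs, e⟩ := hC k
  by_cases h : p k
  · obtain ⟨t, ht, e'⟩ := hP ⟨k, h⟩
    simp only [Machine.pull, Function.comp_apply] at ht e'
    exact ⟨_, by omega, .ite_true e (by simp [Data.val, truth_of h]) e'⟩
  · obtain ⟨t, ht, e'⟩ := hQ ⟨k, h⟩
    simp only [Machine.pull, Function.comp_apply] at ht e'
    exact ⟨_, by omega, .ite_false e (by simp [Data.val, truth_not h]) e'⟩

open Classical in
theorem ite {p : K → Prop} (hp : M.CompB a p) (hb : M.Comp a b) (hc : M.Comp a c) :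
    M.Comp a fun k => if p k then b k else c k :=
  cases hp ((hb.pull _).congr fun k => (if_pos k.2).symm)
    ((hc.pull _).congr fun k => (if_neg k.2).symm)

theorem iteQ {p : K → Prop} [∀ k, Decidable (p k)] (hp : M.CompB a p) (hq : M.CompQ a q)
    (hr : M.CompQ a r) : M.CompQ a fun k => if p k then q k else r k :=
  (ite hp hq hr).congr fun k => by beta_reduce; split_ifs <;> rfl

theorem congrB {p p' : K → Prop} (hp : M.CompB a p) (h : ∀ k, p k ↔ p' k) : M.CompB a p' :=
  congrQ hp fun k => by rw [propext (h k)]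

theorem not {p : K → Prop} (hp : M.CompB a p) : M.CompB a fun k => ¬p k :=
  (sub (const hp.polyBdd_in (.num 1)) hp).congr fun k => by
    by_cases h : p k <;> simp [truth, h]

theorem and {p p' : K → Prop} (hp : M.CompB a p) (hp' : M.CompB a p') :
    M.CompB a fun k => p k ∧ p' k :=
  (mul hp hp').congr fun k => by
    by_cases h : p k <;> by_cases h' : p' k <;> simp [truth, h, h']

theorem or {p p' : K → Prop} (hp : M.CompB a p) (hp' : M.CompB a p') :
    M.CompB a fun k => p k ∨ p' k :=
  congrB (not (and (not hp) (not hp'))) fun k => by tauto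

/-! #### Bounded loops -/

/-- A `for` loop: `acc k j` is the value of the accumulator after `j` rounds. -/
theorem forLoop {N : K → ℕ} {acc : K → ℕ → Data} {B : K → ℕ}
    (hN : M.CompQ a fun k => (N k : ℚ)) (hNb : M.PolyBdd N) (h0 : M.Comp a fun k => acc k 0)
    (hstep : (M.idx N).Comp (fun x => .pair (.pair (a x.1) (.num (x.2 : ℕ))) (acc x.1 x.2))
      fun x => acc x.1 (x.2 + 1))
    (hB : M.PolyBdd B) (hacc : ∀ k, ∀ j ≤ N k, (acc k j).size ≤ B k) :
    M.Comp a fun k => acc k (N k) := by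
  -- The state of the loop: the context, the loop counter and the accumulator.
  let σ : K → ℕ → Data := fun k j => .pair (.pair (a k) (.num (j : ℕ))) (acc k j)
  have hinit : M.Comp a fun k => σ k 0 :=
    (((refl hN.polyBdd_in).pair (const hN.polyBdd_in (.num 0))).pair h0).congr fun k => by
      simp [σ]
  have hσ : M.PolyBdd fun k => 4 + (a k).size + N k + B k :=
    (((PolyBdd.const 4).add hN.polyBdd_in).add hNb).add hB
  have hσ' : ∀ k, ∀ j ≤ N k, (σ k j).size ≤ 4 + (a k).size + N k + B k := by
    intro k j hj
    have h1 := hacc k j hj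
    have h2 : j.size ≤ N k := (Nat.size_le.2 j.lt_two_pow_self).trans hj
    simp only [σ, Data.size, Rat.num_natCast, Int.natAbs_natCast, Rat.den_natCast, Nat.size_one]
    omega
  have hcond : (M.idx fun k => N k + 1).CompB (fun x => σ x.1 x.2)
      fun x => ((x.2 : ℕ) : ℚ) + 1 ≤ N x.1 := by
    have hr : (M.idx fun k => N k + 1).Comp (fun x => σ x.1 x.2) (fun x => σ x.1 x.2) :=
      refl ((hσ.pull Sigma.fst).of_le fun x => hσ' x.1 x.2 (Nat.le_of_lt_succ x.2.2))
    exact (hr.fst.snd.add (const hr.polyBdd_in (.num 1))).le (hr.fst.fst.trans (hN.pull Sigma.fst))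
  have hbody : (M.idx N).Comp (fun x => σ x.1 x.2) (fun x => σ x.1 (x.2 + 1)) := by
    have hr : (M.idx N).Comp (fun x => σ x.1 x.2) (fun x => σ x.1 x.2) :=
      refl ((hσ.pull Sigma.fst).of_le fun x => hσ' x.1 x.2 x.2.2.le)
    refine ((hr.fst.fst.pair (hr.fst.snd.add (const hr.polyBdd_in (.num 1)))).pair
      hstep).congr fun x => ?_
    simp [σ, Data.fst]
  obtain ⟨C, pC, hC⟩ := hcond
  obtain ⟨P, pP, hP⟩ := hbody
  have hloop : M.Comp (fun k => σ k 0) fun k => σ k (N k) := by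
    refine of_exec (.loop C P) ((hNb.add (.const 1)).mul ((PolyBdd.const 1).add
      ((PolyBdd.const 3).mul ((PolyBdd.size.eval pC).add (PolyBdd.size.eval pP))))) fun k =>
      Exec.exists_loop ?_ ?_ ?_
    · intro j hj
      obtain ⟨t, ht, e⟩ := hC ⟨k, j, by omega⟩
      refine ⟨_, ?_, t, ht.trans (Nat.le_add_right _ _), e⟩
      have : (j : ℚ) + 1 ≤ N k := by exact_mod_cast hj
      simp [Data.val, truth, this]
    · obtain ⟨t, ht, e⟩ := hC ⟨k, N k, by omega⟩
      refine ⟨_, ?_, t, ht.trans (Nat.le_add_right _ _), e⟩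
      simp [Data.val, truth]
    · intro j hj
      obtain ⟨t, ht, e⟩ := hP ⟨k, j, hj⟩
      exact ⟨t, ht.trans (Nat.le_add_left _ _), e⟩
  have hend : M.Comp (fun k => σ k (N k)) fun k => acc k (N k) :=
    (refl (hσ.of_le fun k => hσ' k _ le_rfl)).snd
  exact (hinit.trans hloop).trans hend

variable {N : K → ℕ}

/-- The context of the body of a loop over `i < N k`. -/
theorem polyBdd_idx (ha : M.PolyBdd fun k => (a k).size) (hNb : M.PolyBdd N) :
    (M.idx N).PolyBdd fun x => (Data.pair (a x.1) (.num ((x.2 : ℕ) : ℚ))).size := by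
  refine (((PolyBdd.const 3).add (ha.pull Sigma.fst)).add (hNb.pull Sigma.fst)).of_le fun x => ?_
  have : (x.2 : ℕ).size ≤ N x.1 :=
    (Nat.size_le.2 (x.2 : ℕ).lt_two_pow_self).trans x.2.2.le
  simp only [Data.size, Rat.num_natCast, Int.natAbs_natCast, Rat.den_natCast, Nat.size_one,
    Function.comp_apply]
  omega

/-- An expression in the outer variables may be used in the body of a loop. -/
theorem weaken (hb : M.Comp a b) (hNb : M.PolyBdd N) :
    (M.idx N).Comp (fun x => .pair (a x.1) (.num ((x.2 : ℕ) : ℚ))) fun x => b x.1 :=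
  (refl (polyBdd_idx hb.polyBdd_in hNb)).fst.trans (hb.pull Sigma.fst)

/-- The loop counter may be used in the body of a loop. -/
theorem counter (ha : M.PolyBdd fun k => (a k).size) (hNb : M.PolyBdd N) :
    (M.idx N).CompQ (fun x => .pair (a x.1) (.num ((x.2 : ℕ) : ℚ))) fun x => ((x.2 : ℕ) : ℚ) :=
  (refl (polyBdd_idx ha hNb)).snd

/-- A sum over a loop counter.  No bound on the partial sums is needed, by `Data.size_sum_le`. -/
theorem sum {v : ∀ k, Fin (N k) → ℚ} (hN : M.CompQ a fun k => (N k : ℚ)) (hNb : M.PolyBdd N)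
    (hv : (M.idx N).CompQ (fun x => .pair (a x.1) (.num ((x.2 : ℕ) : ℚ))) fun x => v x.1 x.2) :
    M.CompQ a fun k => ∑ i, v k i := by
  let w : K → ℕ → ℚ := fun k i => if h : i < N k then v k ⟨i, h⟩ else 0
  have hw : ∀ k (i : Fin (N k)), w k i = v k i := fun k i => by simp [w]
  obtain ⟨B, hB, hB'⟩ := hv.polyBdd_out.exists_unif
  have hsize : ∀ k, ∀ j ≤ N k, (Data.num (∑ i ∈ Finset.range j, w k i)).size ≤
      2 + 3 * (N k * B k) := by
    intro k j hj
    refine (Data.size_sum_le _ _).trans ?_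
    gcongr
    calc ∑ i ∈ Finset.range j, (Data.num (w k i)).size ≤ ∑ i ∈ Finset.range j, B k := by
          refine Finset.sum_le_sum fun i hi => ?_
          have hi : i < N k := (Finset.mem_range.1 hi).trans_le hj
          rw [hw k ⟨i, hi⟩]
          exact hB' k ⟨i, hi⟩
      _ ≤ N k * B k := by
          rw [Finset.sum_const, Finset.card_range, smul_eq_mul]
          gcongr
  have hBb := (PolyBdd.const 2).add ((PolyBdd.const (M := M) 3).mul (hNb.mul hB))
  refine (forLoop (acc := fun k j => .num (∑ i ∈ Finset.range j, w k i)) hN hNb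
    ((const hN.polyBdd_in (.num 0)).congr fun k => by simp) ?_ hBb hsize).congr fun k => ?_
  · have hr : (M.idx N).Comp _ _ := refl (a := fun x : Σ k, Fin (N k) =>
      .pair (.pair (a x.1) (.num ((x.2 : ℕ) : ℚ))) (.num (∑ i ∈ Finset.range x.2, w x.1 i)))
      ((((PolyBdd.const 1).add (polyBdd_idx hN.polyBdd_in hNb)).add
        (hBb.pull Sigma.fst)).of_le fun x => by
          have := hsize x.1 x.2 x.2.2.le
          rw [Data.size]
          exact Nat.add_le_add_left this _)
    refine Comp.congr (add hr.snd (hr.fst.trans hv)) fun x => ?_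
    rw [Finset.sum_range_succ, hw]
  · rw [← Fin.sum_univ_eq_sum_range]
    simp only [hw]

/-- Tabulation of a function on `{0, …, N k - 1}`. -/
theorem ofFn {g : ∀ k, Fin (N k) → Data} (hN : M.CompQ a fun k => (N k : ℚ))
    (hNb : M.PolyBdd N)
    (hg : (M.idx N).Comp (fun x => .pair (a x.1) (.num ((x.2 : ℕ) : ℚ))) fun x => g x.1 x.2) :
    M.Comp a fun k => Data.ofFn (g k) := by
  obtain ⟨B, hB, hB'⟩ := hg.polyBdd_out.exists_unif
  -- The list is built from its end, as lists grow at their heads.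
  let acc : K → ℕ → Data := fun k j => .ofList ((List.ofFn (g k)).drop (N k - j))
  have hBb := (PolyBdd.const (M := M) 2).add (hNb.mul ((PolyBdd.const 1).add hB))
  have hsize : ∀ k, ∀ j ≤ N k, (acc k j).size ≤ 2 + N k * (1 + B k) := by
    intro k j hj
    refine (Data.size_ofList_le _ (B k) fun x hx => ?_).trans ?_
    · obtain ⟨i, rfl⟩ := (List.mem_ofFn' _ _).1 (List.mem_of_mem_drop hx)
      exact hB' k i
    · gcongr
      simp
  refine (forLoop (acc := acc) hN hNb
    ((const hN.polyBdd_in (.num 0)).congr fun k => by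
      simp [acc, List.drop_of_length_le, Data.ofList])
    ?_ hBb hsize).congr fun k => by simp [acc, Data.ofFn]
  have hr : (M.idx N).Comp _ _ := refl (a := fun x : Σ k, Fin (N k) =>
    .pair (.pair (a x.1) (.num ((x.2 : ℕ) : ℚ))) (acc x.1 x.2))
    ((((PolyBdd.const 1).add (polyBdd_idx hN.polyBdd_in hNb)).add
      (hBb.pull Sigma.fst)).of_le fun x => by
        have := hsize x.1 x.2 x.2.2.le
        rw [Data.size]
        exact Nat.add_le_add_left this _)
  let rev : (Σ k, Fin (N k)) → Σ k, Fin (N k) := fun x => ⟨x.1, x.2.rev⟩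
  have hrev : (M.idx N).Comp (fun x => .pair (a x.1) (.num ((x.2 : ℕ) : ℚ)))
      fun x => .pair (a x.1) (.num ((x.2.rev : ℕ) : ℚ)) :=
    (weaken (refl hN.polyBdd_in) hNb).pair <|
      Comp.congr (sub (weaken hN hNb) (add (counter hN.polyBdd_in hNb)
        (const (polyBdd_idx hN.polyBdd_in hNb) (.num 1)))) fun x => by
        rw [Fin.val_rev, Nat.cast_sub (by omega)]
        push_cast
        rfl
  refine Comp.congr (((hr.fst.trans hrev).trans (hg.pull rev)).pair hr.snd) fun x => ?_
  have h1 : N x.1 - x.2 = N x.1 - (x.2 + 1) + 1 := by omega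
  have h2 : N x.1 - (x.2 + 1) < (List.ofFn (g x.1)).length := by
    simp; omega
  simp only [acc]
  rw [List.drop_eq_getElem_cons h2, ← h1]
  simp only [Data.ofList, List.getElem_ofFn, Data.snd, Function.comp_apply, rev]
  congr 2

theorem nth {i : K → ℕ} (hb : M.Comp a b) (hi : M.CompQ a fun k => (i k : ℚ))
    (hib : M.PolyBdd i) : M.Comp a fun k => (b k).nth (i k) := by
  have hsize : ∀ k, ∀ j ≤ i k, (Data.snd^[j] (b k)).size ≤ (b k).size + i k := by
    intro k j hj
    refine le_trans ?_ (Nat.add_le_add_left hj _)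
    clear hj
    induction j with
    | zero => simp
    | succ j ih =>
      rw [Function.iterate_succ_apply']
      have := (Data.snd^[j] (b k)).size_snd_le
      omega
  have hBb := hb.polyBdd_out.add hib
  have := (forLoop (acc := fun k j => Data.snd^[j] (b k)) hi hib (by simpa using hb) ?_
    hBb hsize).fst
  · exact this.congr fun k => by rw [Data.nth_eq_fst_iterate]
  · have hr : (M.idx i).Comp _ _ := refl (a := fun x : Σ k, Fin (i k) =>
      .pair (.pair (a x.1) (.num ((x.2 : ℕ) : ℚ))) (Data.snd^[(x.2 : ℕ)] (b x.1)))
      ((((PolyBdd.const 1).add (polyBdd_idx hb.polyBdd_in hib)).add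
        (hBb.pull Sigma.fst)).of_le fun x => by
          have := hsize x.1 x.2 x.2.2.le
          rw [Data.size]
          exact Nat.add_le_add_left this _)
    refine Comp.congr hr.snd.snd fun x => ?_
    rw [Function.iterate_succ_apply']
    rfl

/-- The value of a tabulated function. -/
theorem nth_ofFn {g : ∀ k, Fin (N k) → Data} {i : ∀ k, Fin (N k)}
    (hb : M.Comp a fun k => Data.ofFn (g k)) (hi : M.CompQ a fun k => ((i k : ℕ) : ℚ))
    (hNb : M.PolyBdd N) : M.Comp a fun k => g k (i k) :=
  (nth hb hi (hNb.of_le fun k => (i k).2.le)).congr fun k => by simp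

theorem forall_fin {p : ∀ k, Fin (N k) → Prop} (hN : M.CompQ a fun k => (N k : ℚ))
    (hNb : M.PolyBdd N)
    (hp : (M.idx N).CompB (fun x => .pair (a x.1) (.num ((x.2 : ℕ) : ℚ))) fun x => p x.1 x.2) :
    M.CompB a fun k => ∀ i, p k i := by
  refine congrB ((sum (v := fun k i => truth (¬p k i)) hN hNb hp.not).le
    (const hN.polyBdd_in (.num 0))) fun k => ?_
  constructor
  · intro h i
    by_contra hi
    have h1 := Finset.single_le_sum (f := fun i => truth (¬p k i))
      (fun j _ => truth_nonneg _) (Finset.mem_univ i)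
    have h2 := h1.trans h
    rw [truth_of hi] at h2
    norm_num at h2
  · intro h
    refine (Finset.sum_eq_zero fun i _ => truth_not (not_not.2 (h i))).le

theorem two_pow {i : K → ℕ} (hi : M.CompQ a fun k => (i k : ℚ)) (hib : M.PolyBdd i) :
    M.CompQ a fun k => 2 ^ i k := by
  have hsize : ∀ k, ∀ j ≤ i k, (Data.num ((2 : ℚ) ^ j)).size ≤ 3 + i k := by
    intro k j hj
    have := Data.size_natCast (2 ^ j)
    rw [Nat.size_pow] at this
    push_cast at this
    omega
  have hBb := (PolyBdd.const 3).add hib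
  refine forLoop (acc := fun k j => .num (2 ^ j)) hi hib
    ((const hi.polyBdd_in (.num 1)).congr fun k => by simp) ?_ hBb hsize
  have hr : (M.idx i).Comp _ _ := refl (a := fun x : Σ k, Fin (i k) =>
    .pair (.pair (a x.1) (.num ((x.2 : ℕ) : ℚ))) (.num (2 ^ (x.2 : ℕ))))
    ((((PolyBdd.const 1).add (polyBdd_idx hi.polyBdd_in hib)).add
      (hBb.pull Sigma.fst)).of_le fun x => by
        have := hsize x.1 x.2 x.2.2.le
        rw [Data.size]
        exact Nat.add_le_add_left this _)
  exact Comp.congr (mul hr.snd (const hr.polyBdd_in (.num 2))) fun x => by rw [pow_succ]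

end Comp

end Machine

/-! ### Expectations over random sets -/

section ExpectOn

variable {ι : Type*} [DecidableEq ι]

/-- The expectation of `g R` for the random set `R ⊆ A` that contains each `i ∈ A` with probability
`y i`, independently. -/
def expectOn (A : Finset ι) (y : ι → ℚ) (g : Finset ι → ℚ) : ℚ :=
  ∑ R ∈ A.powerset, g R * ((∏ i ∈ R, y i) * ∏ i ∈ A \ R, (1 - y i))

theorem multilinear_eq_expectOn {n : ℕ} (f : Finset (Fin n) → ℚ) (y : Fin n → ℚ) :
    multilinear f y = expectOn Finset.univ y f := by
  simp [multilinear, expectOn, Finset.compl_eq_univ_sdiff]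

theorem expectOn_empty (y : ι → ℚ) (g : Finset ι → ℚ) : expectOn ∅ y g = g ∅ := by
  simp [expectOn]

theorem expectOn_insert {A : Finset ι} {a : ι} (ha : a ∉ A) (y : ι → ℚ) (g : Finset ι → ℚ) :
    expectOn (insert a A) y g =
      y a * expectOn A y (fun R => g (insert a R)) + (1 - y a) * expectOn A y g := by
  unfold expectOn
  rw [Finset.sum_powerset_insert ha, add_comm, Finset.mul_sum, Finset.mul_sum]
  congr 1 <;> refine Finset.sum_congr rfl fun R hR => ?_
  · have haR : a ∉ R := fun h => ha (Finset.mem_powerset.1 hR h)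
    rw [Finset.prod_insert haR, Finset.insert_sdiff_insert, Finset.sdiff_insert_of_notMem ha]
    ring
  · have haR : a ∉ R := fun h => ha (Finset.mem_powerset.1 hR h)
    rw [Finset.insert_sdiff_of_notMem _ haR,
      Finset.prod_insert fun h => ha (Finset.mem_sdiff.1 h).1]
    ring

theorem expectOn_mono {A : Finset ι} {y : ι → ℚ} (hy : ∀ i ∈ A, 0 ≤ y i ∧ y i ≤ 1)
    {g g' : Finset ι → ℚ} (h : ∀ R ⊆ A, (∀ i ∈ R, y i ≠ 0) → g R ≤ g' R) :
    expectOn A y g ≤ expectOn A y g' := by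
  refine Finset.sum_le_sum fun R hR => ?_
  rw [Finset.mem_powerset] at hR
  by_cases h0 : ∀ i ∈ R, y i ≠ 0
  · refine mul_le_mul_of_nonneg_right (h R hR h0) (mul_nonneg ?_ ?_)
    · exact Finset.prod_nonneg fun i hi => (hy i (hR hi)).1
    · exact Finset.prod_nonneg fun i hi => sub_nonneg.2 (hy i (Finset.mem_sdiff.1 hi).1).2
  · push Not at h0
    obtain ⟨i, hi, h0⟩ := h0
    simp [Finset.prod_eq_zero hi h0]

theorem expectOn_congr {A : Finset ι} {y : ι → ℚ} {g g' : Finset ι → ℚ}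
    (h : ∀ R ⊆ A, g R = g' R) : expectOn A y g = expectOn A y g' :=
  Finset.sum_congr rfl fun R hR => by rw [h R (Finset.mem_powerset.1 hR)]

theorem expectOn_sub (A : Finset ι) (y : ι → ℚ) (g g' : Finset ι → ℚ) :
    expectOn A y (fun R => g R - g' R) = expectOn A y g - expectOn A y g' := by
  simp [expectOn, sub_mul]

theorem expectOn_mul_sum {κ : Type*} (s : Finset κ) (A : Finset ι) (y : ι → ℚ) (c : ℚ)
    (g : κ → Finset ι → ℚ) :
    expectOn A y (fun R => c * ∑ k ∈ s, g k R) = c * ∑ k ∈ s, expectOn A y (g k) := by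
  simp only [expectOn, Finset.mul_sum, Finset.sum_mul, mul_assoc]
  exact Finset.sum_comm

theorem expectOn_const (A : Finset ι) (y : ι → ℚ) (c : ℚ) : expectOn A y (fun _ => c) = c := by
  induction A using Finset.induction_on with
  | empty => simp [expectOn_empty]
  | insert b A hb ih => rw [expectOn_insert hb, ih]; ring

/-- The second moment about a point at distance `c` from the mean of a sum of independent
variables. -/
theorem expectOn_sq (A : Finset ι) (y a : ι → ℚ) (c : ℚ) :
    expectOn A y (fun R => (c + (∑ i ∈ R, a i - ∑ i ∈ A, a i * y i)) ^ 2) =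
      c ^ 2 + ∑ i ∈ A, a i ^ 2 * (y i * (1 - y i)) := by
  induction A using Finset.induction_on generalizing c with
  | empty => simp [expectOn_empty]
  | insert b A hb ih =>
    have h1 := ih (c + a b * (1 - y b))
    have h2 := ih (c - a b * y b)
    rw [expectOn_insert hb, Finset.sum_insert hb, Finset.sum_insert hb]
    have e1 : expectOn A y (fun R => (c + (∑ i ∈ insert b R, a i -
          (a b * y b + ∑ i ∈ A, a i * y i))) ^ 2) =
        expectOn A y (fun R => (c + a b * (1 - y b) +
          (∑ i ∈ R, a i - ∑ i ∈ A, a i * y i)) ^ 2) :=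
      expectOn_congr fun R hR => by
        rw [Finset.sum_insert fun h => hb (hR h)]
        ring
    have e2 : expectOn A y (fun R => (c + (∑ i ∈ R, a i -
          (a b * y b + ∑ i ∈ A, a i * y i))) ^ 2) =
        expectOn A y (fun R => (c - a b * y b +
          (∑ i ∈ R, a i - ∑ i ∈ A, a i * y i)) ^ 2) :=
      expectOn_congr fun R _ => by ring
    rw [e1, e2, h1, h2]
    ring

/-- Lowering the probability of `i` by `δ` costs at most `δ` times the largest marginal value of
`i`. -/
theorem expectOn_sub_le {A : Finset ι} {y q : ι → ℚ} {D : ι → ℚ}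
    (hq : ∀ i ∈ A, 0 ≤ q i ∧ q i ≤ y i ∧ y i ≤ 1) {f : Finset ι → ℚ}
    (hf : ∀ i S, f (insert i S) - f S ≤ D i) :
    expectOn A y f - ∑ i ∈ A, (y i - q i) * D i ≤ expectOn A q f := by
  induction A using Finset.induction_on generalizing f with
  | empty => simp [expectOn_empty]
  | insert a A ha ih =>
    obtain ⟨h0, h1, h2⟩ := hq a (by simp)
    have hq' : ∀ i ∈ A, 0 ≤ q i ∧ q i ≤ y i ∧ y i ≤ 1 := fun i hi => hq i (by simp [hi])
    have e1 := ih hq' (f := fun R => f (insert a R)) fun i S => by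
      rw [Finset.insert_comm]
      exact hf i _
    have e2 := ih hq' hf
    have e3 : expectOn A y (fun R => f (insert a R)) - expectOn A y f ≤ D a := by
      rw [← expectOn_sub]
      calc _ ≤ expectOn A y (fun _ => D a) :=
            expectOn_mono (fun i hi => ⟨(hq' i hi).1.trans (hq' i hi).2.1, (hq' i hi).2.2⟩)
              fun R _ _ => hf a R
        _ = D a := expectOn_const _ _ _
    rw [expectOn_insert ha, expectOn_insert ha, Finset.sum_insert ha]
    nlinarith [mul_le_mul_of_nonneg_left e1 h0,
      mul_le_mul_of_nonneg_left e2 (by linarith : 0 ≤ 1 - q a),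
      mul_le_mul_of_nonneg_left e3 (sub_nonneg.2 h1)]

/-- The extension by expectation of a submodular function is concave along the segment from the
origin to `y`. -/
theorem le_expectOn_smul {A : Finset ι} {y : ι → ℚ} {t : ℚ} (ht0 : 0 ≤ t) (ht1 : t ≤ 1)
    (hy : ∀ i ∈ A, 0 ≤ y i ∧ y i ≤ 1) {f : Finset ι → ℚ}
    (hf : ∀ S T, f (S ∪ T) + f (S ∩ T) ≤ f S + f T) :
    t * expectOn A y f + (1 - t) * f ∅ ≤ expectOn A (fun i => t * y i) f := by
  induction A using Finset.induction_on generalizing f with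
  | empty => simp only [expectOn_empty]; linarith
  | insert a A ha ih =>
    obtain ⟨h0, h1⟩ := hy a (by simp)
    have hy' : ∀ i ∈ A, 0 ≤ y i ∧ y i ≤ 1 := fun i hi => hy i (by simp [hi])
    have e1 := ih hy' (f := fun R => f (insert a R)) fun S T => by
      rw [Finset.insert_union_distrib, Finset.insert_inter_distrib]
      exact hf _ _
    have e2 := ih hy' hf
    have e3 : expectOn A y (fun R => f (insert a R)) - expectOn A y f ≤ f {a} - f ∅ := by
      rw [← expectOn_sub]
      rw [← expectOn_const A y (f {a} - f ∅)]
      refine expectOn_mono hy' fun R hR _ => ?_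
      have := hf {a} R
      have haR : a ∉ R := fun h => ha (hR h)
      rw [Finset.singleton_inter_of_notMem haR, ← Finset.insert_eq] at this
      linarith
    rw [expectOn_insert ha, expectOn_insert ha]
    simp only [insert_empty_eq] at e1
    have hta : 0 ≤ t * y a := mul_nonneg ht0 h0
    have hta' : 0 ≤ 1 - t * y a := by nlinarith
    nlinarith [mul_le_mul_of_nonneg_left e1 hta, mul_le_mul_of_nonneg_left e2 hta',
      mul_le_mul_of_nonneg_left e3 (mul_nonneg hta (sub_nonneg.2 ht1))]

end ExpectOn

/-! ### Submodular functions -/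

section Submodular

variable {n : ℕ} {f : Finset (Fin n) → ℚ}

theorem Submodular.union_le (hf : Submodular f) (h0 : ∀ S, 0 ≤ f S) (S T : Finset (Fin n)) :
    f (S ∪ T) ≤ f S + f T := by
  linarith [hf S T, h0 (S ∩ T)]

theorem Submodular.insert_sub_le (hf : Submodular f) (h0 : ∀ S, 0 ≤ f S) (i : Fin n)
    (S : Finset (Fin n)) : f (insert i S) - f S ≤ f {i} := by
  have := hf.union_le h0 {i} S
  rw [← Finset.insert_eq] at this
  linarith

/-- The marginal value of a set is at most the sum of the marginal values of its elements. -/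
theorem Submodular.union_sub_le (hf : Submodular f) {T B : Finset (Fin n)} {m : ℚ}
    (hm : ∀ i ∈ B, f (insert i T) - f T ≤ m) (hTB : Disjoint T B) :
    f (T ∪ B) - f T ≤ B.card * m := by
  induction B using Finset.induction_on with
  | empty => simp
  | insert a B ha ih =>
    have h1 := ih (fun i hi => hm i (by simp [hi]))
      (hTB.mono_right (Finset.subset_insert _ _))
    have h2 := hm a (by simp)
    have h3 := hf (insert a T) (T ∪ B)
    have haT : a ∉ T := fun h => Finset.disjoint_left.1 hTB h (by simp)
    have e1 : insert a T ∪ (T ∪ B) = T ∪ insert a B := by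
      ext; simp
    have e2 : insert a T ∩ (T ∪ B) = T := by
      ext x
      simp only [Finset.mem_inter, Finset.mem_insert, Finset.mem_union]
      constructor
      · rintro ⟨rfl | h, h'⟩
        · exact h'.resolve_right ha
        · exact h
      · intro h; exact ⟨.inr h, .inl h⟩
    rw [e1, e2] at h3
    rw [Finset.card_insert_of_notMem ha]
    push_cast
    linarith

/-- A set of total weight `w` whose elements have weight at most `1/2` can be split into at most
`1 + 2 * w` sets of weight at most `1`. -/
theorem Submodular.le_of_packing (hf : Submodular f) (h0 : ∀ S, 0 ≤ f S) {w : Fin n → ℚ}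
    (hw : ∀ i, 0 ≤ w i) {O : ℚ} {W : Finset (Fin n)} (hW : ∀ i ∈ W, w i ≤ 1 / 2)
    (hO : ∀ V ⊆ W, ∑ i ∈ V, w i ≤ 1 → f V ≤ O) : f W ≤ (1 + 2 * ∑ i ∈ W, w i) * O := by
  have hO0 : 0 ≤ O := (h0 ∅).trans (hO ∅ (by simp) (by simp))
  induction W using Finset.strongInduction with
  | H W ih =>
    have hpos : 0 ≤ ∑ i ∈ W, w i := Finset.sum_nonneg fun i _ => hw i
    by_cases h : ∑ i ∈ W, w i ≤ 1
    · have := hO W (Finset.Subset.refl W) h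
      nlinarith
    obtain ⟨V, hV, hmax⟩ := Finset.exists_max_image (W.powerset.filter fun V => ∑ i ∈ V, w i ≤ 1)
      Finset.card ⟨∅, by simp⟩
    rw [Finset.mem_filter, Finset.mem_powerset] at hV
    have hVW : V ≠ W := by rintro rfl; exact h hV.2
    obtain ⟨a, haW, haV⟩ := Finset.exists_of_ssubset (lt_of_le_of_ne hV.1 hVW)
    have hVw : 1 / 2 < ∑ i ∈ V, w i := by
      by_contra hlt
      have := hmax (insert a V) (by
        rw [Finset.mem_filter, Finset.mem_powerset, Finset.sum_insert haV]
        exact ⟨Finset.insert_subset haW hV.1, by linarith [hW a haW]⟩)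
      rw [Finset.card_insert_of_notMem haV] at this
      omega
    have hVne : V.Nonempty := by
      rw [Finset.nonempty_iff_ne_empty]
      rintro rfl
      norm_num at hVw
    have h1 := ih (W \ V) (Finset.sdiff_ssubset hV.1 hVne)
      (fun i hi => hW i (Finset.mem_sdiff.1 hi).1)
      (fun U hU => hO U (hU.trans Finset.sdiff_subset))
    have h2 := hO V hV.1 hV.2
    have h3 := hf.union_le h0 V (W \ V)
    rw [Finset.union_sdiff_of_subset hV.1] at h3
    have h4 := Finset.sum_sdiff (f := w) hV.1
    nlinarith

end Submodular

/-! ### Residual instances -/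

namespace Instance

variable {d n : ℕ} (I : Instance d n) (f : Finset (Fin n) → ℚ)

theorem Feasible.mono {I : Instance d n} {S T : Finset (Fin n)} (hT : I.Feasible T)
    (h : S ⊆ T) : I.Feasible S := fun r =>
  (Finset.sum_le_sum_of_subset_of_nonneg h fun i _ _ => I.cost_nonneg i r).trans (hT r)

theorem le_opt {S : Finset (Fin n)} (hS : I.Feasible S) : f S ≤ I.opt f :=
  Finset.le_sup' f (by simpa using hS)

theorem exists_eq_opt : ∃ S, I.Feasible S ∧ f S = I.opt f := by
  obtain ⟨S, hS, h⟩ := Finset.exists_mem_eq_sup' I.feasible_nonempty f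
  exact ⟨S, by simpa using hS, h.symm⟩

/-- The budget that is left after buying `T`. -/
def slack (T : Finset (Fin n)) (r : Fin d) : ℚ := I.budget r - ∑ i ∈ T, I.cost i r

variable {I} in
theorem Feasible.slack_nonneg {T : Finset (Fin n)} (hT : I.Feasible T) (r : Fin d) :
    0 ≤ I.slack T r := sub_nonneg.2 (hT r)

/-- The elements of `T`, and those with a cost of at most a fraction `1 / D` of the budget that is
left after buying `T`. -/
def Light (D : ℕ) (T : Finset (Fin n)) (i : Fin n) : Prop :=
  i ∈ T ∨ ∀ r, D * I.cost i r ≤ I.slack T r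

/-- The factor by which the cost of an element `i` that is not light is raised.  It makes sure that
`y i * f {i}` is negligible for every fractional solution `y`, provided that `f T` is positive; for
`f T = 0` the factor is `0`. -/
def penalty (D N : ℕ) (T : Finset (Fin n)) (i : Fin n) : ℚ := N * D * n * f {i} / f T

open Classical in
/-- The instance that is left after buying `T`: the elements of `T` are free, and those that are not
light are expensive. -/
noncomputable def residual (h0 : ∀ S, 0 ≤ f S) (D N : ℕ) (T : Finset (Fin n))
    (hT : I.Feasible T) : Instance d n where
  cost i r := if i ∈ T then 0 else
    if I.Light D T i then I.cost i r else I.cost i r * penalty f D N T i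
  budget r := I.slack T r
  cost_nonneg i r := by
    have h1 := I.cost_nonneg i r
    have h2 := h0 {i}
    have h3 := h0 T
    unfold penalty
    split_ifs <;> positivity
  budget_nonneg r := hT.slack_nonneg r

variable {I f}

/-- There are a small set `T` and an almost optimal set `S ⊇ T`, all of whose elements are light
with respect to `T`: take for `T` a largest subset of an optimal set that contains few elements in
comparison with its value.  The remaining elements of the optimal set have a small marginal value,
and those of them that are not light are few. -/
theorem exists_light (hf : Submodular f) (h0 : ∀ S, 0 ≤ f S) {D N : ℕ} (hN : 0 < N)
    (hD : 0 < d * D) (hO : 0 < I.opt f) :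
    ∃ T S : Finset (Fin n), T.card ≤ d * D * N + 1 ∧ 0 < f T ∧ T ⊆ S ∧ I.Feasible S ∧
      (∀ i ∈ S, I.Light D T i) ∧ (1 - 1 / N) * I.opt f ≤ f S := by
  classical
  obtain ⟨W, hW, hWO⟩ := I.exists_eq_opt f
  set O := I.opt f with hOdef
  set m : ℚ := O / (d * D * N : ℕ) with hm
  have hDN : 0 < d * D * N := Nat.mul_pos hD hN
  have hDNq : (0 : ℚ) < (d * D * N : ℕ) := by exact_mod_cast hDN
  have hmpos : 0 < m := div_pos hO hDNq
  let 𝒯 := W.powerset.filter fun T => 0 < f T ∧ (T.card - 1 : ℚ) * m ≤ f T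
  -- Some set of at most one element has a positive value, as otherwise `f W = 0`.
  have hne : 𝒯.Nonempty := by
    have hone : ∃ T ⊆ W, T.card ≤ 1 ∧ 0 < f T := by
      by_contra! hcon
      have he : f ∅ = 0 := le_antisymm (hcon ∅ (by simp) (by simp)) (h0 _)
      have := hf.union_sub_le (T := ∅) (B := W) (m := 0)
        (fun i hi => by
          have := hcon {i} (by simpa using hi) (by simp)
          simpa [he] using this) (by simp)
      simp [he, hWO] at this
      linarith
    obtain ⟨T, hTW, hT1, hT⟩ := hone
    refine ⟨T, Finset.mem_filter.2 ⟨Finset.mem_powerset.2 hTW, hT, ?_⟩⟩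
    have : (T.card : ℚ) ≤ 1 := by exact_mod_cast hT1
    nlinarith
  obtain ⟨T, hT, hmax⟩ := Finset.exists_max_image 𝒯 Finset.card hne
  obtain ⟨hTW, hTpos, hTcard⟩ := Finset.mem_filter.1 hT
  rw [Finset.mem_powerset] at hTW
  have hTf := hW.mono hTW
  have hmarg : ∀ i ∈ W \ T, f (insert i T) - f T ≤ m := by
    intro i hi
    rw [Finset.mem_sdiff] at hi
    by_contra! hlt
    have := hmax (insert i T) (Finset.mem_filter.2 ⟨Finset.mem_powerset.2
      (Finset.insert_subset hi.1 hTW), by linarith, by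
        rw [Finset.card_insert_of_notMem hi.2]
        push_cast
        linarith⟩)
    rw [Finset.card_insert_of_notMem hi.2] at this
    omega
  set B := W.filter fun i => ¬I.Light D T i with hB
  have hBT : Disjoint T B := Finset.disjoint_left.2 fun i hi hi' =>
    (Finset.mem_filter.1 hi').2 (.inl hi)
  -- In each dimension, at most `D` elements of `W` are too expensive.
  have hBcard : B.card ≤ d * D := by
    have hsub : B ⊆ Finset.univ.biUnion fun r : Fin d =>
        (W \ T).filter fun i => I.slack T r < D * I.cost i r := by
      intro i hi
      obtain ⟨hiW, hi⟩ := Finset.mem_filter.1 hi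
      simp only [Light, not_or, not_forall, not_le] at hi
      obtain ⟨hiT, r, hr⟩ := hi
      exact Finset.mem_biUnion.2 ⟨r, Finset.mem_univ _,
        Finset.mem_filter.2 ⟨Finset.mem_sdiff.2 ⟨hiW, hiT⟩, hr⟩⟩
    refine (Finset.card_le_card hsub).trans ?_
    refine (Finset.card_biUnion_le_card_mul _ _ D fun r _ => ?_).trans (by simp)
    set X := (W \ T).filter fun i => I.slack T r < D * I.cost i r with hX
    have hXs : ∑ i ∈ X, I.cost i r ≤ I.slack T r := by
      have h1 : ∑ i ∈ X, I.cost i r ≤ ∑ i ∈ W \ T, I.cost i r :=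
        Finset.sum_le_sum_of_subset_of_nonneg (Finset.filter_subset _ _)
          fun i _ _ => I.cost_nonneg i r
      have h2 := Finset.sum_sdiff (f := fun i => I.cost i r) hTW
      have h3 := hW r
      simp only [slack]
      linarith
    by_contra! hlt
    have hXne : X.Nonempty := Finset.card_pos.1 (by omega)
    have h1 : X.card * I.slack T r < D * ∑ i ∈ X, I.cost i r := by
      rw [Finset.mul_sum, ← nsmul_eq_mul, ← Finset.sum_const]
      exact Finset.sum_lt_sum_of_nonempty hXne fun i hi => (Finset.mem_filter.1 hi).2
    have h2 : (D : ℚ) ≤ X.card := by exact_mod_cast hlt.le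
    have h3 := hTf.slack_nonneg r
    have h4 : (0 : ℚ) ≤ D := Nat.cast_nonneg _
    nlinarith [mul_le_mul_of_nonneg_left hXs h4]
  refine ⟨T, W \ B, ?_, hTpos, ?_, hW.mono Finset.sdiff_subset, ?_, ?_⟩
  · have h1 := (I.le_opt f hTf)
    have h2 : (T.card - 1 : ℚ) * m ≤ (d * D * N : ℕ) * m := by
      rw [hm, mul_div_cancel₀ _ hDNq.ne', ← hm]
      exact hTcard.trans h1
    have h3 := le_of_mul_le_mul_right h2 hmpos
    have h4 : (T.card : ℚ) ≤ (d * D * N + 1 : ℕ) := by push_cast at h3 ⊢; linarith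
    exact_mod_cast h4
  · exact Finset.subset_sdiff.2 ⟨hTW, hBT⟩
  · intro i hi
    rw [Finset.mem_sdiff] at hi
    by_contra h
    exact hi.2 (Finset.mem_filter.2 ⟨hi.1, h⟩)
  · -- Removing `B` from `W` costs at most what adding `B` to `T` yields.
    have h1 := hf.union_sub_le (T := T) (B := B) (m := m) (fun i hi => hmarg i
      (Finset.mem_sdiff.2 ⟨(Finset.mem_filter.1 hi).1,
        fun h => (Finset.mem_filter.1 hi).2 (.inl h)⟩)) hBT
    have h2 := hf (W \ B) (T ∪ B)
    have hBW : B ⊆ W := Finset.filter_subset _ _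
    have e1 : W \ B ∪ (T ∪ B) = W := by
      ext x
      have := @hTW x
      have := @hBW x
      simp only [Finset.mem_union, Finset.mem_sdiff]
      tauto
    have e2 : W \ B ∩ (T ∪ B) = T := by
      ext x
      have := @hTW x
      have := @Finset.disjoint_left.1 hBT x
      simp only [Finset.mem_union, Finset.mem_sdiff, Finset.mem_inter]
      tauto
    rw [e1, e2, hWO] at h2
    have h3 : (B.card : ℚ) * m ≤ (d * D : ℕ) * m :=
      mul_le_mul_of_nonneg_right (by exact_mod_cast hBcard) hmpos.le
    have h4 : ((d * D : ℕ) : ℚ) * m = 1 / N * O := by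
      rw [hm]
      have : ((d * D : ℕ) : ℚ) ≠ 0 := by exact_mod_cast hD.ne'
      have : (N : ℚ) ≠ 0 := by exact_mod_cast hN.ne'
      rw [Nat.cast_mul (d * D) N]
      field_simp
    linarith

/-- A set of light elements that contains `T` is still feasible after buying `T`. -/
theorem le_residual_opt (h0 : ∀ S, 0 ≤ f S) {D N : ℕ} {T S : Finset (Fin n)}
    (hT : I.Feasible T) (hTS : T ⊆ S) (hS : I.Feasible S) (hl : ∀ i ∈ S, I.Light D T i) :
    f S ≤ (I.residual f h0 D N T hT).opt f := by
  classical
  refine le_opt _ _ fun r => ?_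
  simp only [residual, slack]
  have h1 := Finset.sum_sdiff (f := fun i => I.cost i r) hTS
  have h2 := hS r
  have h3 : ∑ i ∈ S, (if i ∈ T then 0 else
      if I.Light D T i then I.cost i r else I.cost i r * penalty f D N T i) =
      ∑ i ∈ S \ T, I.cost i r := by
    rw [← Finset.sum_sdiff hTS, Finset.sum_eq_zero (s := T) fun i hi => if_pos hi, add_zero]
    refine Finset.sum_congr rfl fun i hi => ?_
    rw [Finset.mem_sdiff] at hi
    rw [if_neg hi.2, if_pos (hl i hi.1)]
  linarith

/-! ### Rounding a fractional solution -/

/-- The value that is lost by the penalty is negligible. -/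
theorem FracFeasible.mul_le (h0 : ∀ S, 0 ≤ f S) {D N : ℕ} (hD : 0 < D) (hN : 0 < N)
    {T : Finset (Fin n)} (hT : I.Feasible T) (hTpos : 0 < f T) {y : Fin n → ℚ}
    (hy : (I.residual f h0 D N T hT).FracFeasible y) {i : Fin n} (hi : ¬I.Light D T i) :
    y i * f {i} ≤ 1 / (N * n) * I.opt f := by
  classical
  have hO := I.le_opt f hT
  have hn : (0 : ℚ) < n := by exact_mod_cast i.pos
  have hDq : (0 : ℚ) < D := by exact_mod_cast hD
  have hNq : (0 : ℚ) < N := by exact_mod_cast hN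
  have hi' := hi
  simp only [Light, not_or, not_forall, not_le] at hi'
  obtain ⟨hiT, r, hr⟩ := hi'
  have hsl := hT.slack_nonneg r
  have hc : 0 < I.cost i r := by
    by_contra h
    nlinarith [I.cost_nonneg i r]
  have h1 : y i * (I.residual f h0 D N T hT).cost i r ≤ I.slack T r := by
    refine le_trans ?_ (hy.2 r)
    exact Finset.single_le_sum
      (f := fun i => y i * (I.residual f h0 D N T hT).cost i r)
      (fun j _ => mul_nonneg (hy.1 j).1 (Instance.cost_nonneg _ j r)) (Finset.mem_univ i)
  simp only [residual, if_neg hiT, if_neg hi] at h1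
  have h2 : y i * penalty f D N T i < D := by
    by_contra! h
    nlinarith [mul_le_mul_of_nonneg_left h hc.le]
  have h3 : y i * f {i} * (N * n) < f T := by
    rw [penalty, ← mul_div_assoc, div_lt_iff₀ hTpos] at h2
    nlinarith
  rw [div_mul_eq_mul_div, one_mul, le_div_iff₀ (by positivity)]
  linarith

/-- The probabilities with which the elements are chosen in the rounding of `y`: elements that are
not light are discarded, and the probabilities of the others are scaled down by the factor
`1 - 1 / N` and then rounded down to a multiple of `2 ^ (-b)`. -/
noncomputable def roundProb (I : Instance d n) (D N : ℕ) (T : Finset (Fin n)) (y : Fin n → ℚ)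
    (b : ℕ) (i : Fin n) : ℚ :=
  open Classical in if I.Light D T i then (⌊(1 - 1 / N) * y i * 2 ^ b⌋₊ : ℚ) / 2 ^ b else 0

theorem roundProb_nonneg (D N : ℕ) (T : Finset (Fin n)) (y : Fin n → ℚ) (b : ℕ) (i : Fin n) :
    0 ≤ I.roundProb D N T y b i := by
  unfold roundProb
  split_ifs <;> positivity

theorem one_sub_inv_nonneg {N : ℕ} (hN : 0 < N) : (0 : ℚ) ≤ 1 - 1 / N := by
  have : (1 : ℚ) ≤ N := by exact_mod_cast hN
  rw [sub_nonneg, div_le_one (by linarith)]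
  exact this

theorem roundProb_le {D N : ℕ} (hN : 0 < N) (T : Finset (Fin n)) {y : Fin n → ℚ} (b : ℕ)
    {i : Fin n} (hy : 0 ≤ y i) : I.roundProb D N T y b i ≤ (1 - 1 / N) * y i := by
  have h := one_sub_inv_nonneg hN
  unfold roundProb
  split_ifs
  · rw [div_le_iff₀ (by positivity)]
    exact Nat.floor_le (by positivity)
  · positivity

/-- Discarding elements, scaling and rounding down the probabilities costs little.  Rounding down
costs at most `f {i} / 2 ^ (n + N)` for each light `i`, where `{i}` is feasible and
`n * N ≤ 2 ^ (n + N)`. -/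
theorem le_multilinear_roundProb (hf : Submodular f) (h0 : ∀ S, 0 ≤ f S) {D N : ℕ} (hD : 0 < D)
    (hN : 0 < N) {T : Finset (Fin n)} (hT : I.Feasible T) (hTpos : 0 < f T)
    {y : Fin n → ℚ} (hy : (I.residual f h0 D N T hT).FracFeasible y) :
    (1 - 1 / N) * multilinear f y - 1 / N * I.opt f ≤
      multilinear f (I.roundProb D N T y (n + N)) := by
  classical
  have hNq : (0 : ℚ) < N := by exact_mod_cast hN
  have hO : 0 ≤ I.opt f := (h0 T).trans (I.le_opt f hT)
  have he := one_sub_inv_nonneg hN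
  have he1 : (1 - 1 / N : ℚ) ≤ 1 := by
    have : (0 : ℚ) ≤ 1 / N := by positivity
    linarith
  rw [multilinear_eq_expectOn, multilinear_eq_expectOn]
  have h1 := le_expectOn_smul (A := Finset.univ) he he1 (fun i _ => hy.1 i) hf
  have h2 := expectOn_sub_le (A := Finset.univ) (y := fun i => (1 - 1 / N) * y i)
    (q := I.roundProb D N T y (n + N)) (D := fun i => f {i}) (f := f)
    (fun i _ => ⟨roundProb_nonneg _ _ _ _ _ _, roundProb_le hN _ _ (hy.1 i).1,
      mul_le_one₀ he1 (hy.1 i).1 (hy.1 i).2⟩)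
    (hf.insert_sub_le h0)
  have h3 : ∀ i : Fin n, ((1 - 1 / N) * y i - I.roundProb D N T y (n + N) i) * f {i} ≤
      1 / (N * n) * I.opt f := by
    intro i
    have hn : (0 : ℚ) < n := by exact_mod_cast i.pos
    by_cases hi : I.Light D T i
    · have hif : f {i} ≤ I.opt f := by
        refine I.le_opt f ?_
        rcases hi with hi | hi
        · exact hT.mono (by simpa using hi)
        · intro r
          have h4 := hi r
          have h5 : I.slack T r ≤ I.budget r := by
            have : 0 ≤ ∑ i ∈ T, I.cost i r := Finset.sum_nonneg fun i _ => I.cost_nonneg i r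
            simp only [slack]; linarith
          have h6 : (1 : ℚ) ≤ D := by exact_mod_cast hD
          have := I.cost_nonneg i r
          simp only [Finset.sum_singleton]
          nlinarith
      have h4 : (1 - 1 / N) * y i - I.roundProb D N T y (n + N) i ≤ 1 / (N * n) := by
        simp only [roundProb, if_pos hi]
        have h5 := (Nat.lt_floor_add_one ((1 - 1 / N) * y i * 2 ^ (n + N))).le
        have h6 : (1 - 1 / N) * y i -
            (⌊(1 - 1 / N) * y i * 2 ^ (n + N)⌋₊ : ℚ) / 2 ^ (n + N) ≤ 1 / 2 ^ (n + N) := by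
          rw [sub_le_iff_le_add, ← add_div, le_div_iff₀ (by positivity)]
          linarith
        refine h6.trans (one_div_le_one_div_of_le (by positivity) ?_)
        rw [pow_add, mul_comm]
        have hn2 : (n : ℚ) ≤ 2 ^ n := by exact_mod_cast n.lt_two_pow_self.le
        have hN2 : (N : ℚ) ≤ 2 ^ N := by exact_mod_cast N.lt_two_pow_self.le
        exact mul_le_mul hn2 hN2 hNq.le (by positivity)
      exact mul_le_mul h4 hif (h0 _) (by positivity)
    · have h4 := hy.mul_le h0 hD hN hT hTpos hi
      simp only [roundProb, if_neg hi, sub_zero]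
      have h5 := (hy.1 i).1
      have h6 := h0 {i}
      nlinarith [mul_le_mul_of_nonneg_right he1 (mul_nonneg h5 h6)]
  have h4 : ∑ i, ((1 - 1 / N) * y i - I.roundProb D N T y (n + N) i) * f {i} ≤
      1 / N * I.opt f := by
    refine (Finset.sum_le_sum fun i _ => h3 i).trans ?_
    rcases Nat.eq_zero_or_pos n with rfl | hn
    · simp; positivity
    · have hn : (0 : ℚ) < n := by exact_mod_cast hn
      simp only [Finset.sum_const, Finset.card_univ, Fintype.card_fin, nsmul_eq_mul]
      apply le_of_eq
      field_simp
  have h5 := mul_nonneg (by linarith : 0 ≤ 1 - (1 - 1 / N : ℚ)) (h0 ∅)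
  linarith

/-- The set `R`, or the empty set if `R` is not feasible. -/
def repair (I : Instance d n) (R : Finset (Fin n)) : Finset (Fin n) :=
  if I.Feasible R then R else ∅

theorem feasible_repair (I : Instance d n) (R : Finset (Fin n)) : I.Feasible (I.repair R) := by
  unfold repair
  split_ifs with h
  · exact h
  · exact I.feasible_empty

/-- The cost of an element in units of the budget left after buying `T`; elements of `T` are free,
and so is everything in a dimension in which nothing is left. -/
def relCost (I : Instance d n) (T : Finset (Fin n)) (r : Fin d) (i : Fin n) : ℚ :=
  if i ∈ T then 0 else I.cost i r / I.slack T r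

theorem relCost_nonneg {T : Finset (Fin n)} (hT : I.Feasible T) (r : Fin d) (i : Fin n) :
    0 ≤ I.relCost T r i := by
  have := I.cost_nonneg i r
  have := hT.slack_nonneg r
  unfold relCost
  split_ifs <;> positivity

theorem relCost_le {D : ℕ} (hD : 0 < D) {T : Finset (Fin n)} (hT : I.Feasible T) (r : Fin d)
    {i : Fin n} (hi : I.Light D T i) : I.relCost T r i ≤ 1 / D := by
  have hDq : (0 : ℚ) < D := by exact_mod_cast hD
  unfold relCost
  split_ifs with h
  · positivity
  · rcases (hT.slack_nonneg r).eq_or_lt with h' | h'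
    · rw [← h', div_zero]; positivity
    · rw [div_le_div_iff₀ h' hDq]
      linarith [(hi.resolve_left h) r]

theorem sum_relCost_mul {D : ℕ} (hD : 0 < D) {T : Finset (Fin n)} (hT : I.Feasible T)
    (r : Fin d) {V : Finset (Fin n)} (hV : ∀ i ∈ V, I.Light D T i) :
    (∑ i ∈ V, I.relCost T r i) * I.slack T r = ∑ i ∈ V \ T, I.cost i r := by
  have hDq : (0 : ℚ) < D := by exact_mod_cast hD
  rw [Finset.sum_mul, Finset.sdiff_eq_filter, Finset.sum_filter]
  refine Finset.sum_congr rfl fun i hi => ?_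
  unfold relCost
  by_cases h : i ∈ T
  · simp [h]
  · rw [if_neg h, if_pos h]
    rcases (hT.slack_nonneg r).eq_or_lt with h' | h'
    · have h1 := ((hV i hi).resolve_left h) r
      have h2 := I.cost_nonneg i r
      have h3 : I.cost i r = 0 := by nlinarith
      simp [h3]
    · rw [div_mul_cancel₀ _ h'.ne']

/-- An infeasible set of light elements overruns the remaining budget in some dimension. -/
theorem exists_relCost_gt {D : ℕ} (hD : 0 < D) {T : Finset (Fin n)} (hT : I.Feasible T)
    {R : Finset (Fin n)} (hR : ∀ i ∈ R, I.Light D T i) (hRf : ¬I.Feasible R) :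
    ∃ r, 1 < ∑ i ∈ R, I.relCost T r i := by
  by_contra! h
  refine hRf fun r => ?_
  have h1 := mul_le_mul_of_nonneg_right (h r) (hT.slack_nonneg r)
  rw [sum_relCost_mul hD hT r hR, one_mul, slack] at h1
  have h2 : ∑ i ∈ R, I.cost i r ≤ ∑ i ∈ R \ T, I.cost i r + ∑ i ∈ T, I.cost i r := by
    rw [← Finset.sum_union Finset.sdiff_disjoint]
    refine Finset.sum_le_sum_of_subset_of_nonneg ?_ fun i _ _ => I.cost_nonneg i r
    intro i hi
    by_cases i ∈ T <;> simp [*]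
  linarith

/-- The value of a set of light elements, in terms of its cost. -/
theorem value_le (hf : Submodular f) (h0 : ∀ S, 0 ≤ f S) {D : ℕ} (hD : 0 < D) (hDd : 2 * d ≤ D)
    {T : Finset (Fin n)} (hT : I.Feasible T) {R : Finset (Fin n)}
    (hR : ∀ i ∈ R, I.Light D T i) :
    f R ≤ (2 + 2 * ∑ r, ∑ i ∈ R, I.relCost T r i) * I.opt f := by
  have hDq : (0 : ℚ) < D := by exact_mod_cast hD
  have hnn := fun r i => relCost_nonneg (I := I) hT r i
  have h1 : f (R ∩ T) ≤ I.opt f := I.le_opt f (hT.mono Finset.inter_subset_right)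
  have h2 := hf.le_of_packing h0 (w := fun i => ∑ r, I.relCost T r i) (O := I.opt f)
    (W := R \ T) (fun i => Finset.sum_nonneg fun r _ => hnn r i)
    (fun i hi => by
      have hi := hR i (Finset.mem_sdiff.1 hi).1
      calc ∑ r, I.relCost T r i ≤ ∑ _r : Fin d, (1 / D : ℚ) :=
            Finset.sum_le_sum fun r _ => relCost_le hD hT r hi
        _ = d / D := by simp [div_eq_mul_inv]
        _ ≤ 1 / 2 := by
          rw [div_le_div_iff₀ hDq two_pos]
          have : (2 * d : ℚ) ≤ D := by exact_mod_cast hDd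
          linarith)
    (fun V hV hVw => by
      refine I.le_opt f ?_
      by_contra hVf
      obtain ⟨r, hr⟩ := exists_relCost_gt hD hT
        (fun i hi => hR i (Finset.mem_sdiff.1 (hV hi)).1) hVf
      rw [Finset.sum_comm] at hVw
      have := Finset.single_le_sum (f := fun r => ∑ i ∈ V, I.relCost T r i)
        (fun r _ => Finset.sum_nonneg fun i _ => hnn r i) (Finset.mem_univ r)
      linarith)
  have h3 := hf.union_le h0 (R ∩ T) (R \ T)
  rw [Finset.union_comm, Finset.sdiff_union_inter] at h3
  have h4 : ∑ i ∈ R \ T, ∑ r, I.relCost T r i ≤ ∑ r, ∑ i ∈ R, I.relCost T r i := by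
    rw [Finset.sum_comm]
    exact Finset.sum_le_sum fun r _ => Finset.sum_le_sum_of_subset_of_nonneg
      Finset.sdiff_subset fun i _ _ => hnn r i
  have h5 : 0 ≤ I.opt f := (h0 _).trans h1
  nlinarith [mul_le_mul_of_nonneg_right h4 h5]

/-- Replacing infeasible sets by the empty set costs little in expectation.  By Chebyshev's
inequality, a set chosen at random with the given probabilities is unlikely to be infeasible, and
its value is bounded in terms of its cost.  The loss is at most `C * opt` times the sum of the `d`
variances of the relative costs, with `C = (2 + 4 * d) * N ^ 2 + 2`.  Each variance is at most
`1 / D`, and `D` is chosen such that `C * d / D = 1 / N`. -/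
theorem le_multilinear_repair (hf : Submodular f) (h0 : ∀ S, 0 ≤ f S) {D N : ℕ} (hN : 0 < N)
    (hd : 0 < d) (hD : D = N * d * ((2 + 4 * d) * N ^ 2 + 2)) {T : Finset (Fin n)}
    (hT : I.Feasible T) {q : Fin n → ℚ} (hq : ∀ i, 0 ≤ q i ∧ q i ≤ 1)
    (hql : ∀ i, q i ≠ 0 → I.Light D T i)
    (hmean : ∀ r, ∑ i, I.relCost T r i * q i ≤ 1 - 1 / N) :
    multilinear f q - 1 / N * I.opt f ≤ multilinear (fun R => f (I.repair R)) q := by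
  have hNq : (1 : ℚ) ≤ N := by exact_mod_cast hN
  have hdq : (1 : ℚ) ≤ d := by exact_mod_cast hd
  have hO : 0 ≤ I.opt f := (h0 T).trans (I.le_opt f hT)
  set C : ℚ := (2 + 4 * d) * N ^ 2 + 2 with hC
  have hCpos : 0 < C := by positivity
  have hDC : (D : ℚ) = N * d * C := by rw [hD, hC]; push_cast; ring
  have hD2 : 2 * d ≤ D := by
    rw [hD]
    calc 2 * d = 1 * d * 2 := by ring
      _ ≤ N * d * ((2 + 4 * d) * N ^ 2 + 2) := by gcongr <;> omega
  have hD0 : 0 < D := by omega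
  have hDq : (0 : ℚ) < D := by exact_mod_cast hD0
  let Z : Fin d → Finset (Fin n) → ℚ := fun r R =>
    (0 + (∑ i ∈ R, I.relCost T r i - ∑ i, I.relCost T r i * q i)) ^ 2
  -- An infeasible `R` overruns the budget in a dimension `r`, where `Z r R ≥ (1 / N) ^ 2`.
  have hpt : ∀ R : Finset (Fin n), (∀ i ∈ R, q i ≠ 0) →
      f R - f (I.repair R) ≤ (C * I.opt f) * ∑ r, Z r R := by
    intro R hR
    have hRl : ∀ i ∈ R, I.Light D T i := fun i hi => hql i (hR i hi)
    have hZ : ∀ r, 0 ≤ Z r R := fun r => sq_nonneg _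
    have hZs : 0 ≤ ∑ r, Z r R := Finset.sum_nonneg fun r _ => hZ r
    by_cases hRf : I.Feasible R
    · rw [repair, if_pos hRf, sub_self]
      positivity
    obtain ⟨r, hr⟩ := exists_relCost_gt hD0 hT hRl hRf
    have h1 : 1 ≤ (N : ℚ) ^ 2 * ∑ r, Z r R := by
      have h2 : Z r R ≤ ∑ r, Z r R :=
        Finset.single_le_sum (f := fun r => Z r R) (fun r _ => hZ r) (Finset.mem_univ r)
      have h3 : (1 / N : ℚ) ^ 2 ≤ Z r R :=
        pow_le_pow_left₀ (by positivity) (by linarith [hmean r]) 2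
      calc (1 : ℚ) = N ^ 2 * (1 / N) ^ 2 := by field_simp
        _ ≤ _ := mul_le_mul_of_nonneg_left (h3.trans h2) (by positivity)
    have h4 : ∑ r, ∑ i ∈ R, I.relCost T r i ≤ 2 * d + ∑ r, Z r R := by
      calc ∑ r, ∑ i ∈ R, I.relCost T r i ≤ ∑ r, (2 + Z r R) := by
            refine Finset.sum_le_sum fun s _ => ?_
            have h5 := hmean s
            have h6 : (0 : ℚ) ≤ 1 / N := by positivity
            simp only [Z]
            nlinarith [sq_nonneg (∑ i ∈ R, I.relCost T s i - ∑ i, I.relCost T s i * q i - 1 / 2)]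
        _ = _ := by
            rw [Finset.sum_add_distrib]
            simp [mul_comm]
    have h5 := value_le hf h0 hD0 hD2 hT hRl
    have h6 : 2 + 2 * ∑ r, ∑ i ∈ R, I.relCost T r i ≤ C * ∑ r, Z r R := by
      rw [hC]
      nlinarith [mul_le_mul_of_nonneg_left h1 (by positivity : (0 : ℚ) ≤ 2 + 4 * d)]
    have h7 := h0 (I.repair R)
    have h8 := mul_le_mul_of_nonneg_right h6 hO
    linarith
  have hvar : ∀ r, expectOn Finset.univ q (Z r) ≤ 1 / D := by
    intro r
    rw [expectOn_sq]
    have h1 : ∀ i, I.relCost T r i ^ 2 * (q i * (1 - q i)) ≤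
        1 / D * (I.relCost T r i * q i) := by
      intro i
      obtain ⟨hq0, hq1⟩ := hq i
      rcases eq_or_ne (q i) 0 with h | h
      · simp [h]
      · have h2 := relCost_le hD0 hT r (hql i h)
        have h3 := relCost_nonneg hT r i
        have h4 := mul_nonneg h3 hq0
        nlinarith [mul_le_mul_of_nonneg_right h2 h4,
          mul_nonneg (mul_nonneg h3 h4) hq0]
    have h2 := Finset.sum_le_sum fun i (_ : i ∈ Finset.univ) => h1 i
    rw [← Finset.mul_sum] at h2
    have h3 : (1 / D : ℚ) * ∑ i, I.relCost T r i * q i ≤ 1 / D * 1 :=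
      mul_le_mul_of_nonneg_left ((hmean r).trans (by
        have : (0 : ℚ) ≤ 1 / N := by positivity
        linarith)) (by positivity)
    linarith
  have h1 : expectOn Finset.univ q (fun R => f R - f (I.repair R)) ≤
      expectOn Finset.univ q (fun R => (C * I.opt f) * ∑ r, Z r R) :=
    expectOn_mono (fun i _ => hq i) fun R _ hR => hpt R hR
  rw [expectOn_sub, expectOn_mul_sum] at h1
  have h2 : ∑ r, expectOn Finset.univ q (Z r) ≤ d * (1 / D) := by
    refine (Finset.sum_le_sum fun r _ => hvar r).trans ?_
    simp
  have h3 : C * I.opt f * (d * (1 / D)) = 1 / N * I.opt f := by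
    rw [hDC]
    field_simp
  have h4 := mul_le_mul_of_nonneg_left h2 (mul_nonneg hCpos.le hO)
  rw [multilinear_eq_expectOn, multilinear_eq_expectOn]
  linarith

/-- Scaling by `1 - 1 / N` leaves room in the budget for the deviations from the mean. -/
theorem sum_relCost_roundProb_le (h0 : ∀ S, 0 ≤ f S) {D N : ℕ} (hN : 0 < N)
    {T : Finset (Fin n)} (hT : I.Feasible T) {y : Fin n → ℚ}
    (hy : (I.residual f h0 D N T hT).FracFeasible y) (b : ℕ) (r : Fin d) :
    ∑ i, I.relCost T r i * I.roundProb D N T y b i ≤ 1 - 1 / N := by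
  classical
  have he := one_sub_inv_nonneg hN
  have hs := hT.slack_nonneg r
  have h1 : ∀ i, I.relCost T r i * I.roundProb D N T y b i ≤
      (1 - 1 / N) * (y i * (I.residual f h0 D N T hT).cost i r) / I.slack T r := by
    intro i
    have hy0 := (hy.1 i).1
    have hc := (I.residual f h0 D N T hT).cost_nonneg i r
    by_cases hi : I.Light D T i
    · by_cases hiT : i ∈ T
      · simp only [relCost, if_pos hiT, zero_mul]
        positivity
      · have h2 := roundProb_le (I := I) (D := D) hN T b hy0
        simp only [relCost, if_neg hiT, residual, if_pos hi]
        have h3 := mul_le_mul_of_nonneg_left h2 (div_nonneg (I.cost_nonneg i r) hs)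
        refine h3.trans (le_of_eq ?_)
        ring
    · simp only [roundProb, if_neg hi, mul_zero]
      positivity
  refine (Finset.sum_le_sum fun i _ => h1 i).trans ?_
  rw [← Finset.sum_div, ← Finset.mul_sum]
  rcases hs.eq_or_lt with h | h
  · rw [← h, div_zero]; exact he
  · rw [div_le_iff₀ h]
    exact mul_le_mul_of_nonneg_left (hy.2 r) he

/-- Rounding a fractional solution of the residual instance. -/
theorem le_multilinear_repair_roundProb (hf : Submodular f) (h0 : ∀ S, 0 ≤ f S) {D N : ℕ}
    (hN : 0 < N) (hd : 0 < d) (hD : D = N * d * ((2 + 4 * d) * N ^ 2 + 2)) {T : Finset (Fin n)}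
    (hT : I.Feasible T) (hTpos : 0 < f T) {y : Fin n → ℚ}
    (hy : (I.residual f h0 D N T hT).FracFeasible y) :
    (1 - 1 / N) * multilinear f y - 2 / N * I.opt f ≤
      multilinear (fun R => f (I.repair R)) (I.roundProb D N T y (n + N)) := by
  have hD0 : 0 < D := by rw [hD]; positivity
  have h1 := le_multilinear_roundProb hf h0 hD0 hN hT hTpos hy
  have h2 := le_multilinear_repair hf h0 hN hd hD hT
    (q := I.roundProb D N T y (n + N))
    (fun i => ⟨roundProb_nonneg _ _ _ _ _ _, (roundProb_le hN _ _ (hy.1 i).1).trans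
      (mul_le_one₀ (by
        have : (0 : ℚ) ≤ 1 / N := by positivity
        linarith) (hy.1 i).1 (hy.1 i).2)⟩)
    (fun i hi => by
      by_contra h
      exact hi (by simp only [roundProb, if_neg h]))
    (sum_relCost_roundProb_le h0 hN hT hy _)
  have h3 : (2 / N : ℚ) * I.opt f = 1 / N * I.opt f + 1 / N * I.opt f := by ring
  linarith

end Instance

/-! ### Random bits -/

/-- The average of `g` over a finite type. -/
def average {Ω : Type*} [Fintype Ω] (g : Ω → ℚ) : ℚ := (∑ ω, g ω) / Fintype.card Ω

theorem expect_eq_average {m : ℕ} (g : (Fin m → Bool) → ℚ) : expect g = average g := by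
  simp [expect, average]

theorem average_mono {Ω : Type*} [Fintype Ω] {g g' : Ω → ℚ} (h : ∀ ω, g ω ≤ g' ω) :
    average g ≤ average g' :=
  div_le_div_of_nonneg_right (Finset.sum_le_sum fun ω _ => h ω) (Nat.cast_nonneg _)

theorem average_equiv {Ω Ω' : Type*} [Fintype Ω] [Fintype Ω'] (e : Ω ≃ Ω') (g : Ω' → ℚ) :
    average (fun ω => g (e ω)) = average g := by
  rw [average, average, Fintype.card_congr e, e.sum_comp]

theorem average_prod {Ω Ω' : Type*} [Fintype Ω] [Fintype Ω'] (g : Ω × Ω' → ℚ) :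
    average g = average fun ω => average fun ω' => g (ω, ω') := by
  simp only [average, Fintype.sum_prod_type, Fintype.card_prod, Nat.cast_mul]
  rw [← Finset.sum_div, div_div, mul_comm (Fintype.card Ω : ℚ)]

theorem average_const {Ω : Type*} [Fintype Ω] [Nonempty Ω] (c : ℚ) :
    average (fun _ : Ω => c) = c := by
  have : (Fintype.card Ω : ℚ) ≠ 0 := Nat.cast_ne_zero.2 Fintype.card_ne_zero
  simp [average, this]

theorem average_mul_sub {Ω : Type*} [Fintype Ω] [Nonempty Ω] (t c : ℚ) (g : Ω → ℚ) :
    average (fun ω => t * g ω - c) = t * average g - c := by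
  have : (Fintype.card Ω : ℚ) ≠ 0 := Nat.cast_ne_zero.2 Fintype.card_ne_zero
  simp only [average, Finset.sum_sub_distrib, ← Finset.mul_sum, Finset.sum_const,
    Finset.card_univ, nsmul_eq_mul]
  field_simp

/-- Those among independent uniform bits that are listed by an injection are again independent
and uniform. -/
theorem average_comp_injective {ι κ : Type*} [Fintype ι] [Fintype κ] [DecidableEq ι]
    [DecidableEq κ] {φ : ι → κ} (hφ : Function.Injective φ) (g : (ι → Bool) → ℚ) :
    average (fun ω : κ → Bool => g (ω ∘ φ)) = average g := by
  classical
  let e₁ := Equiv.piEquivPiSubtypeProd (fun x => x ∈ Set.range φ) (fun _ : κ => Bool)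
  let e₂ : (Set.range φ → Bool) ≃ (ι → Bool) :=
    (Equiv.ofInjective φ hφ).symm.arrowCongr (Equiv.refl Bool)
  have h1 : (fun ω : κ → Bool => g (ω ∘ φ)) = fun ω => (fun u => g (e₂ u.1)) (e₁ ω) := by
    funext ω
    congr 1
  rw [h1, average_equiv e₁ fun u => g (e₂ u.1), average_prod]
  simp only [average_const]
  exact average_equiv e₂ g

/-- The number with the given binary digits. -/
def ofBits {b : ℕ} (β : Fin b → Bool) : ℚ := ∑ j, (if β j = true then 1 else 0) * 2 ^ (j : ℕ)

theorem card_ofBits_add_one_le (b : ℕ) {z : ℚ} (hz : 0 ≤ z) (hz1 : z ≤ 2 ^ b) :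
    (Finset.univ.filter fun β : Fin b → Bool => ofBits β + 1 ≤ z).card = ⌊z⌋₊ := by
  let e : (Fin b → Bool) ≃ Fin (2 ^ b) :=
    ((Equiv.refl (Fin b)).arrowCongr finTwoEquiv.symm).trans finFunctionFinEquiv
  have he : ∀ β, ofBits β = ((e β : ℕ) : ℚ) := by
    intro β
    simp only [ofBits, e, Equiv.trans_apply, finFunctionFinEquiv_apply, Nat.cast_sum]
    refine Finset.sum_congr rfl fun j _ => ?_
    push_cast
    congr 1
    cases h : β j <;> simp [Equiv.arrowCongr, h, finTwoEquiv]
  have h1 : (Finset.univ.filter fun β : Fin b → Bool => ofBits β + 1 ≤ z).map e.toEmbedding =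
      Finset.univ.filter fun x : Fin (2 ^ b) => (x : ℕ) < ⌊z⌋₊ := by
    ext x
    simp only [Finset.mem_map_equiv, Finset.mem_filter, Finset.mem_univ, true_and, he,
      Equiv.apply_symm_apply]
    rw [Nat.lt_iff_add_one_le, Nat.le_floor_iff hz]
    push_cast
    rfl
  rw [← Finset.card_map e.toEmbedding, h1, Fin.card_filter_val_lt, min_eq_right]
  exact_mod_cast Nat.floor_le_floor hz1 |>.trans (by
    rw [show ((2 : ℚ) ^ b) = ((2 ^ b : ℕ) : ℚ) by push_cast; rfl, Nat.floor_natCast])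

/-- If the events `E i` concern independent variables, the random set of those `i` for which `E i`
happens contains each `i` independently. -/
theorem average_events {n : ℕ} {Ω : Type*} [Fintype Ω] [DecidableEq Ω] [Nonempty Ω]
    (E : Fin n → Finset Ω) (g : Finset (Fin n) → ℚ) :
    average (fun ω : Fin n → Ω => g (Finset.univ.filter fun i => ω i ∈ E i)) =
      multilinear g fun i => ((E i).card : ℚ) / Fintype.card Ω := by
  have hc : (Fintype.card Ω : ℚ) ≠ 0 := Nat.cast_ne_zero.2 Fintype.card_ne_zero
  unfold average multilinear
  rw [← Finset.sum_fiberwise (s := Finset.univ)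
    (g := fun ω : Fin n → Ω => Finset.univ.filter fun i => ω i ∈ E i), Finset.sum_div]
  refine Finset.sum_congr rfl fun R _ => ?_
  have h1 : (Finset.univ.filter fun ω : Fin n → Ω =>
      (Finset.univ.filter fun i => ω i ∈ E i) = R) =
      Fintype.piFinset fun i => if i ∈ R then E i else (E i)ᶜ := by
    ext ω
    simp only [Finset.mem_filter, Finset.mem_univ, true_and, Fintype.mem_piFinset, Finset.ext_iff]
    refine forall_congr' fun i => ?_
    by_cases h : i ∈ R <;> simp [h]
  have h2 : ∑ ω ∈ Finset.univ.filter (fun ω : Fin n → Ω =>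
      (Finset.univ.filter fun i => ω i ∈ E i) = R),
      g (Finset.univ.filter fun i => ω i ∈ E i) =
      (Fintype.piFinset fun i => if i ∈ R then E i else (E i)ᶜ).card * g R := by
    rw [← h1, ← nsmul_eq_mul, ← Finset.sum_const]
    refine Finset.sum_congr rfl fun ω hω => ?_
    rw [(Finset.mem_filter.1 hω).2]
  rw [h2, Fintype.card_piFinset, mul_comm, mul_div_assoc]
  congr 1
  have h3 : ∀ i, (((if i ∈ R then E i else (E i)ᶜ).card : ℕ) : ℚ) / Fintype.card Ω =
      if i ∈ R then ((E i).card : ℚ) / Fintype.card Ω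
        else 1 - ((E i).card : ℚ) / Fintype.card Ω := by
    intro i
    split_ifs
    · rfl
    · rw [Finset.card_compl, Nat.cast_sub (Finset.card_le_univ _)]
      field_simp
  rw [Fintype.card_fun, Fintype.card_fin, Nat.cast_prod, Nat.cast_pow]
  have h4 : (Fintype.card Ω : ℚ) ^ n = ∏ _i : Fin n, (Fintype.card Ω : ℚ) := by simp
  rw [h4, ← Finset.prod_div_distrib, Finset.prod_congr rfl fun i _ => h3 i,
    Finset.prod_ite]
  congr 2
  · ext i; simp
  · ext i; simp

/-- The outcome of the random choices in the rounding of `y`: an element `i` that is light is chosen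
if the number with the random digits `β i` is below a threshold. -/
noncomputable def Instance.sample {d n b : ℕ} (I : Instance d n) (D N : ℕ)
    (T : Finset (Fin n)) (y : Fin n → ℚ) (β : Fin n → Fin b → Bool) : Finset (Fin n) :=
  open Classical in Finset.univ.filter fun i =>
    I.Light D T i ∧ ofBits (β i) + 1 ≤ (1 - 1 / N) * y i * 2 ^ b

/-- For uniform digits, the sample contains each element independently, with the probability
`roundProb`. -/
theorem Instance.average_sample {d n b : ℕ} (I : Instance d n) {D N : ℕ} (hN : 0 < N)
    (T : Finset (Fin n)) {y : Fin n → ℚ} (hy : ∀ i, 0 ≤ y i ∧ y i ≤ 1)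
    (g : Finset (Fin n) → ℚ) :
    average (fun β : Fin n → Fin b → Bool => g (I.sample D N T y β)) =
      multilinear g (I.roundProb D N T y b) := by
  classical
  have he := Instance.one_sub_inv_nonneg hN
  have he1 : (1 - 1 / N : ℚ) ≤ 1 := by
    have : (0 : ℚ) ≤ 1 / N := by positivity
    linarith
  have h := average_events (Ω := Fin b → Bool) (fun i => Finset.univ.filter fun β =>
    I.Light D T i ∧ ofBits β + 1 ≤ (1 - 1 / N) * y i * 2 ^ b) g
  simp only [Finset.mem_filter, Finset.mem_univ, true_and] at h
  have hs : (fun β : Fin n → Fin b → Bool => g (I.sample D N T y β)) = fun β =>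
      g (Finset.univ.filter fun i =>
        I.Light D T i ∧ ofBits (β i) + 1 ≤ (1 - 1 / N) * y i * 2 ^ b) := by
    funext β
    rw [Instance.sample]
  rw [hs, h]
  congr 1
  funext i
  by_cases hi : I.Light D T i
  · simp only [hi, true_and, Instance.roundProb, if_true]
    have h1 : (1 - 1 / N) * y i * 2 ^ b ≤ (2 : ℚ) ^ b :=
      mul_le_of_le_one_left (by positivity) (mul_le_one₀ he1 (hy i).1 (hy i).2)
    rw [card_ofBits_add_one_le b (mul_nonneg (mul_nonneg he (hy i).1) (by positivity)) h1]
    simp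
  · simp [hi, Instance.roundProb]

/-! ### The algorithm -/

/-- A situation in which the algorithm runs: a function of the class, given by its value oracle,
the costs and the budget, and an infinite tape of bits. -/
structure Situation (d : ℕ) (𝓕 : (n : ℕ) → Set (Finset (Fin n) → ℚ)) where
  n : ℕ
  f : Finset (Fin n) → ℚ
  mem : f ∈ 𝓕 n
  I : Instance d n
  tape : ℕ → Bool

variable {d : ℕ} {𝓕 : (n : ℕ) → Set (Finset (Fin n) → ℚ)}

/-- The machine that runs in these situations. -/
def situationMachine (d : ℕ) (𝓕 : (n : ℕ) → Set (Finset (Fin n) → ℚ)) :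
    Machine (Situation d 𝓕) where
  env s := ⟨fun x => s.f (x.toSet s.n), s.tape⟩
  size s := inputSize s.f s.I

/-- The machine whose situations `k` come with a situation `φ k` of the algorithm and with further
data. -/
abbrev machineOn {K : Type} (φ : K → Situation d 𝓕) : Machine K := (situationMachine d 𝓕).pull φ

namespace Situation

/-- The better one of two sets. -/
def better (s : Situation d 𝓕) (S S' : Finset (Fin s.n)) : Finset (Fin s.n) :=
  if s.f S ≤ s.f S' then S' else S

/-- The best one among `S` and the first `j` of the sets `g 0, g 1, …`. -/
def bestOf (s : Situation d 𝓕) (S : Finset (Fin s.n)) (g : Fin s.n → Finset (Fin s.n)) :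
    ℕ → Finset (Fin s.n)
  | 0 => S
  | j + 1 => if h : j < s.n then s.better (s.bestOf S g j) (g ⟨j, h⟩) else s.bestOf S g j

/-- The output of the algorithm for the continuous problem on the costs and the budget `J`, when it
uses the bits at the even positions of the tape. -/
def runEven (s : Situation d 𝓕) {m : Instance d s.n → ℕ}
    (out : ∀ J, (Fin (m J) → Bool) → Data) (J : Instance d s.n) : Data :=
  out J fun j => s.tape (2 * j)

/-- The random digits for the element `i`; they are found at the odd positions of the tape. -/
def digits (s : Situation d 𝓕) (b : ℕ) (i : Fin s.n) (j : Fin b) : Bool :=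
  s.tape (2 * (i * b + j) + 1)

variable (m : ∀ n : ℕ, (Finset (Fin n) → ℚ) → Instance d n → ℕ)
  (out : ∀ n (f : Finset (Fin n) → ℚ) (J : Instance d n), (Fin (m n f J) → Bool) → Data)

/-- The set found for the guess `T`: solve the residual instance fractionally, and round the
solution at random. -/
noncomputable def guess (h0 : ∀ n, ∀ f ∈ 𝓕 n, ∀ S, 0 ≤ f S) (D N : ℕ) (s : Situation d 𝓕)
    (T : Finset (Fin s.n)) : Finset (Fin s.n) :=
  if hT : s.I.Feasible T then
    s.I.repair (s.I.sample D N T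
      ((s.runEven (out s.n s.f) (s.I.residual s.f (h0 _ _ s.mem) D N T hT)).toVec s.n)
      (s.digits (s.n + N)))
  else ∅

/-- The best one of the sets found for the guesses that arise from `T` by adding at most `j`
elements. -/
noncomputable def search (h0 : ∀ n, ∀ f ∈ 𝓕 n, ∀ S, 0 ≤ f S) (D N : ℕ) (s : Situation d 𝓕) :
    ℕ → Finset (Fin s.n) → Finset (Fin s.n)
  | 0, T => s.guess m out h0 D N T
  | j + 1, T => s.bestOf (s.search h0 D N j T) (fun i => s.search h0 D N j (insert i T)) s.n

variable {s : Situation d 𝓕}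

theorem bestOf_induction {S : Finset (Fin s.n)} {g : Fin s.n → Finset (Fin s.n)}
    {p : Finset (Fin s.n) → Prop} (hS : p S) (hg : ∀ i, p (g i)) (j : ℕ) : p (s.bestOf S g j) := by
  induction j with
  | zero => exact hS
  | succ j ih =>
    simp only [bestOf, better]
    split_ifs
    · exact hg _
    · exact ih
    · exact ih

theorem bestOf_mono (S : Finset (Fin s.n)) (g : Fin s.n → Finset (Fin s.n)) {j j' : ℕ}
    (h : j ≤ j') : s.f (s.bestOf S g j) ≤ s.f (s.bestOf S g j') := by
  induction h with
  | refl => exact le_rfl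
  | step _ ih =>
    refine ih.trans ?_
    simp only [bestOf, better]
    split_ifs with h1 h2
    · exact h2
    · exact le_rfl
    · exact le_rfl

theorem le_bestOf (S : Finset (Fin s.n)) (g : Fin s.n → Finset (Fin s.n)) (i : Fin s.n) :
    s.f (g i) ≤ s.f (s.bestOf S g s.n) := by
  refine le_trans ?_ (bestOf_mono S g (Nat.succ_le_of_lt i.2))
  simp only [bestOf, better, dif_pos i.2]
  split_ifs with h
  · exact le_rfl
  · exact (not_le.1 h).le

variable (h0 : ∀ n, ∀ f ∈ 𝓕 n, ∀ S, 0 ≤ f S) (D N : ℕ)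

theorem feasible_guess (T : Finset (Fin s.n)) : s.I.Feasible (s.guess m out h0 D N T) := by
  unfold guess
  split_ifs
  · exact Instance.feasible_repair _ _
  · exact s.I.feasible_empty

theorem feasible_search (j : ℕ) (T : Finset (Fin s.n)) :
    s.I.Feasible (s.search m out h0 D N j T) := by
  induction j generalizing T with
  | zero => exact feasible_guess _ _ _ _ _ _
  | succ j ih => exact bestOf_induction (ih T) (fun i => ih _) _

/-- The search also covers guesses with fewer than `j` additional elements, as each round
also keeps what is found without adding an element. -/
theorem guess_le_search (j : ℕ) (T W : Finset (Fin s.n)) (hW : W.card ≤ j) :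
    s.f (s.guess m out h0 D N (T ∪ W)) ≤ s.f (s.search m out h0 D N j T) := by
  induction j generalizing T W with
  | zero =>
    obtain rfl : W = ∅ := Finset.card_eq_zero.1 (by omega)
    simp [search]
  | succ j ih =>
    rcases W.eq_empty_or_nonempty with rfl | ⟨i, hi⟩
    · exact (ih T ∅ (by simp)).trans (bestOf_mono _ _ (Nat.zero_le _))
    · have h1 := ih (insert i T) (W.erase i) (by
        have := Finset.card_erase_of_mem hi
        omega)
      rw [Finset.insert_union, ← Finset.union_insert, Finset.insert_erase hi] at h1
      exact h1.trans (le_bestOf _ (fun i => s.search m out h0 D N j (insert i T)) i)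

end Situation

/-! ### The running time of the algorithm -/

open Machine

section Comp

variable {K : Type} {φ : K → Situation d 𝓕} {a : K → Data}

theorem n_le_inputSize {n : ℕ} (f : Finset (Fin n) → ℚ) (I : Instance d n) :
    n ≤ inputSize f I := by
  have h := Data.length_le_size_ofList
    (List.ofFn fun i => Data.ofFn fun r => .num (I.cost i r))
  rw [List.length_ofFn] at h
  simp only [inputSize, Instance.encode, Data.ofFn, Data.size] at h ⊢
  omega

theorem polyBdd_n (φ : K → Situation d 𝓕) : (machineOn φ).PolyBdd fun k => (φ k).n :=
  PolyBdd.size.of_le fun k => n_le_inputSize (φ k).f (φ k).I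

theorem comp_n (h : (machineOn φ).Comp a fun k => (φ k).I.encode) :
    (machineOn φ).CompQ a fun k => ((φ k).n : ℚ) := h.fst

theorem comp_d (h : (machineOn φ).Comp a fun k => (φ k).I.encode) :
    (machineOn φ).CompQ a fun _ => (d : ℚ) := Comp.const h.polyBdd_in _

theorem comp_budget (h : (machineOn φ).Comp a fun k => (φ k).I.encode) {r : K → Fin d}
    (hr : (machineOn φ).CompQ a fun k => ((r k : ℕ) : ℚ)) :
    (machineOn φ).CompQ a fun k => (φ k).I.budget (r k) :=
  Comp.nth_ofFn (N := fun _ => d) (g := fun k r => .num ((φ k).I.budget r)) h.snd.fst hr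
    (.const d)

theorem comp_cost (h : (machineOn φ).Comp a fun k => (φ k).I.encode) {i : ∀ k, Fin (φ k).n}
    (hi : (machineOn φ).CompQ a fun k => ((i k : ℕ) : ℚ)) {r : K → Fin d}
    (hr : (machineOn φ).CompQ a fun k => ((r k : ℕ) : ℚ)) :
    (machineOn φ).CompQ a fun k => (φ k).I.cost (i k) (r k) :=
  Comp.nth_ofFn (N := fun _ => d) (g := fun k r => .num ((φ k).I.cost (i k) r))
    (Comp.nth_ofFn (N := fun k => (φ k).n)
      (g := fun k i => Data.ofFn fun r => .num ((φ k).I.cost i r)) h.snd.snd hi (polyBdd_n φ)) hr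
    (.const d)

theorem comp_value {S : ∀ k, Finset (Fin (φ k).n)}
    (hS : (machineOn φ).Comp a fun k => .ofSet (S k)) :
    (machineOn φ).CompQ a fun k => (φ k).f (S k) := by
  refine (hS.query (PolyBdd.size.of_le fun k => ?_)).congrQ fun k => ?_
  · refine le_trans ?_ (Nat.le_add_left _ _)
    exact Finset.le_sup (f := fun S => (Data.num ((φ k).f S)).size) (Finset.mem_univ _)
  · simp [Machine.pull, situationMachine]

theorem comp_mem {S : ∀ k, Finset (Fin (φ k).n)}
    (hS : (machineOn φ).Comp a fun k => .ofSet (S k)) {i : ∀ k, Fin (φ k).n}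
    (hi : (machineOn φ).CompQ a fun k => ((i k : ℕ) : ℚ)) :
    (machineOn φ).CompB a fun k => i k ∈ S k :=
  (Comp.nth_ofFn (N := fun k => (φ k).n)
    (g := fun k i => .num (if i ∈ S k then 1 else 0)) hS hi (polyBdd_n φ)).congrQ fun k => by
      rw [ite_eq_truth]

theorem comp_ofSet (h : (machineOn φ).Comp a fun k => (φ k).I.encode)
    {S : ∀ k, Finset (Fin (φ k).n)}
    (hS : ((machineOn φ).idx fun k => (φ k).n).CompB
      (fun x => .pair (a x.1) (.num ((x.2 : ℕ) : ℚ))) fun x => x.2 ∈ S x.1) :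
    (machineOn φ).Comp a fun k => .ofSet (S k) :=
  Comp.ofFn (comp_n h) (polyBdd_n φ) (hS.congrQ fun x => by rw [ite_eq_truth])

theorem comp_sum_cost (h : (machineOn φ).Comp a fun k => (φ k).I.encode)
    {S : ∀ k, Finset (Fin (φ k).n)} (hS : (machineOn φ).Comp a fun k => .ofSet (S k))
    {r : K → Fin d} (hr : (machineOn φ).CompQ a fun k => ((r k : ℕ) : ℚ)) :
    (machineOn φ).CompQ a fun k => ∑ i ∈ S k, (φ k).I.cost i (r k) := by
  have hn := polyBdd_n φ
  refine Comp.congrQ (Comp.sum (v := fun k i => if i ∈ S k then (φ k).I.cost i (r k) else 0)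
    (comp_n h) hn ?_) fun k => by rw [← Finset.sum_filter]; simp
  have hi := Comp.counter h.polyBdd_in hn
  exact Comp.iteQ (comp_mem (φ := fun x : Σ k, Fin (φ k).n => φ x.1) (hS.weaken hn) hi)
    (comp_cost (φ := fun x : Σ k, Fin (φ k).n => φ x.1) (h.weaken hn) hi (hr.weaken hn))
    (Comp.const hi.polyBdd_in (.num 0))

theorem comp_slack (h : (machineOn φ).Comp a fun k => (φ k).I.encode)
    {S : ∀ k, Finset (Fin (φ k).n)} (hS : (machineOn φ).Comp a fun k => .ofSet (S k))
    {r : K → Fin d} (hr : (machineOn φ).CompQ a fun k => ((r k : ℕ) : ℚ)) :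
    (machineOn φ).CompQ a fun k => (φ k).I.slack (S k) (r k) :=
  (comp_budget h hr).sub (comp_sum_cost h hS hr)

theorem comp_feasible (h : (machineOn φ).Comp a fun k => (φ k).I.encode)
    {S : ∀ k, Finset (Fin (φ k).n)} (hS : (machineOn φ).Comp a fun k => .ofSet (S k)) :
    (machineOn φ).CompB a fun k => (φ k).I.Feasible (S k) := by
  have hd : (machineOn φ).PolyBdd fun _ => d := .const d
  have hr := Comp.counter h.polyBdd_in hd
  exact Comp.forall_fin (p := fun k r => ∑ i ∈ S k, (φ k).I.cost i r ≤ (φ k).I.budget r)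
    (comp_d h) hd ((comp_sum_cost (φ := fun x : Σ _ : K, Fin d => φ x.1) (h.weaken hd)
      (hS.weaken hd) hr).le (comp_budget (φ := fun x : Σ _ : K, Fin d => φ x.1) (h.weaken hd) hr))

theorem comp_insert (h : (machineOn φ).Comp a fun k => (φ k).I.encode)
    {T : ∀ k, Finset (Fin (φ k).n)} (hT : (machineOn φ).Comp a fun k => .ofSet (T k))
    {i : ∀ k, Fin (φ k).n} (hi : (machineOn φ).CompQ a fun k => ((i k : ℕ) : ℚ)) :
    (machineOn φ).Comp a fun k => .ofSet (insert (i k) (T k)) := by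
  have hn := polyBdd_n φ
  have hj := Comp.counter h.polyBdd_in hn
  refine comp_ofSet h ((Comp.or ((hj.le (hi.weaken hn)).and ((hi.weaken hn).le hj))
    (comp_mem (φ := fun x : Σ k, Fin (φ k).n => φ x.1) (hT.weaken hn) hj)).congrB fun x => ?_)
  rw [← le_antisymm_iff, Nat.cast_inj, Fin.val_inj, Finset.mem_insert]

theorem comp_empty (h : (machineOn φ).Comp a fun k => (φ k).I.encode) :
    (machineOn φ).Comp a fun k => .ofSet (∅ : Finset (Fin (φ k).n)) := by
  have hj := Comp.counter h.polyBdd_in (polyBdd_n φ)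
  exact comp_ofSet h ((Comp.const hj.polyBdd_in (.num 0)).congrQ fun x =>
    (truth_not (Finset.notMem_empty _)).symm)

theorem comp_light (D : ℕ) (h : (machineOn φ).Comp a fun k => (φ k).I.encode)
    {T : ∀ k, Finset (Fin (φ k).n)} (hT : (machineOn φ).Comp a fun k => .ofSet (T k))
    {i : ∀ k, Fin (φ k).n} (hi : (machineOn φ).CompQ a fun k => ((i k : ℕ) : ℚ)) :
    (machineOn φ).CompB a fun k => (φ k).I.Light D (T k) (i k) := by
  have hd : (machineOn φ).PolyBdd fun _ => d := .const d
  have hr := Comp.counter h.polyBdd_in hd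
  refine Comp.or (comp_mem hT hi) (Comp.forall_fin
    (p := fun k r => D * (φ k).I.cost (i k) r ≤ (φ k).I.slack (T k) r) (comp_d h) hd ?_)
  exact ((Comp.const hr.polyBdd_in (.num D)).mul
    (comp_cost (φ := fun x : Σ _ : K, Fin d => φ x.1) (h.weaken hd) (hi.weaken hd) hr)).le
    (comp_slack (φ := fun x : Σ _ : K, Fin d => φ x.1) (h.weaken hd) (hT.weaken hd) hr)

theorem comp_residual (D N : ℕ) (h0 : ∀ n, ∀ f ∈ 𝓕 n, ∀ S, 0 ≤ f S)
    (h : (machineOn φ).Comp a fun k => (φ k).I.encode)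
    {T : ∀ k, Finset (Fin (φ k).n)} (hT : (machineOn φ).Comp a fun k => .ofSet (T k))
    (hTf : ∀ k, (φ k).I.Feasible (T k)) :
    (machineOn φ).Comp a fun k =>
      ((φ k).I.residual (φ k).f (h0 _ _ (φ k).mem) D N (T k) (hTf k)).encode := by
  classical
  have hd : (machineOn φ).PolyBdd fun _ => d := .const d
  have hn := polyBdd_n φ
  have hbudget : (machineOn φ).Comp a fun k =>
      Data.ofFn fun r => .num ((φ k).I.slack (T k) r) :=
    Comp.ofFn (N := fun _ => d) (comp_d h) hd
      (comp_slack (φ := fun x : Σ _ : K, Fin d => φ x.1) (h.weaken hd) (hT.weaken hd)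
        (Comp.counter h.polyBdd_in hd))
  refine (comp_n h).pair (hbudget.pair (Comp.ofFn (N := fun k => (φ k).n) (comp_n h) hn ?_))
  -- From here on, the element `i` is a variable in scope, and then also the dimension `r`.
  let φ' : (Σ k, Fin (φ k).n) → Situation d 𝓕 := fun x => φ x.1
  have hd' : (machineOn φ').PolyBdd fun _ => d := .const d
  have h' : (machineOn φ').Comp _ fun x => (φ' x).I.encode := h.weaken hn
  have hT' : (machineOn φ').Comp _ fun x => .ofSet (T x.1) := hT.weaken hn
  have hi' : (machineOn φ').CompQ (fun x => .pair (a x.1) (.num ((x.2 : ℕ) : ℚ)))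
      fun x => ((x.2 : ℕ) : ℚ) := Comp.counter h.polyBdd_in hn
  refine Comp.ofFn (M := machineOn φ') (N := fun _ => d) (comp_d h') hd' ?_
  let φ'' : (Σ _ : (Σ k, Fin (φ k).n), Fin d) → Situation d 𝓕 := fun x => φ x.1.1
  have h'' : (machineOn φ'').Comp _ fun x => (φ'' x).I.encode := h'.weaken hd'
  have hT'' : (machineOn φ'').Comp _ fun x => .ofSet (T x.1.1) := hT'.weaken hd'
  have hi'' : (machineOn φ'').CompQ _ fun x => ((x.1.2 : ℕ) : ℚ) := hi'.weaken hd'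
  have hr'' : (machineOn φ'').CompQ (fun x => .pair (.pair (a x.1.1) (.num ((x.1.2 : ℕ) : ℚ)))
      (.num ((x.2 : ℕ) : ℚ))) fun x => ((x.2 : ℕ) : ℚ) :=
    Comp.counter h'.polyBdd_in hd'
  have hc := comp_cost (φ := φ'') (i := fun x => x.1.2) h'' hi'' hr''
  have hpen : (machineOn φ'').CompQ (fun x => .pair (.pair (a x.1.1) (.num ((x.1.2 : ℕ) : ℚ)))
      (.num ((x.2 : ℕ) : ℚ)))
      fun x => Instance.penalty (φ'' x).f D N (T x.1.1) x.1.2 :=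
    ((((Comp.const hr''.polyBdd_in (.num N)).mul (Comp.const hr''.polyBdd_in (.num D))).mul
      (comp_n h'')).mul ((comp_value (φ := φ'') (comp_insert (φ := φ'')
        (i := fun x => x.1.2) h'' (comp_empty h'') hi'')).congrQ fun x => by
          rw [insert_empty_eq])).div
      (comp_value (φ := φ'') hT'')
  exact Comp.iteQ (comp_mem (φ := φ'') (i := fun x => x.1.2) hT'' hi'')
    (Comp.const hr''.polyBdd_in (.num 0))
    (Comp.iteQ (comp_light (φ := φ'') (i := fun x => x.1.2) D h'' hT'' hi'') hc (hc.mul hpen))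

theorem comp_repair (h : (machineOn φ).Comp a fun k => (φ k).I.encode)
    {S : ∀ k, Finset (Fin (φ k).n)} (hS : (machineOn φ).Comp a fun k => .ofSet (S k)) :
    (machineOn φ).Comp a fun k => .ofSet ((φ k).I.repair (S k)) :=
  (Comp.ite (comp_feasible h hS) hS (comp_empty h)).congr fun k => by
    unfold Instance.repair
    split_ifs <;> rfl

theorem comp_digits (h : (machineOn φ).Comp a fun k => (φ k).I.encode) (N : ℕ)
    {i : ∀ k, Fin (φ k).n} (hi : (machineOn φ).CompQ a fun k => ((i k : ℕ) : ℚ)) :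
    (machineOn φ).CompQ a fun k => ofBits ((φ k).digits ((φ k).n + N) (i k)) := by
  have hn := polyBdd_n φ
  have hb : (machineOn φ).PolyBdd fun k => (φ k).n + N := hn.add (.const N)
  have hbc : (machineOn φ).CompQ a fun k => (((φ k).n + N : ℕ) : ℚ) :=
    ((comp_n h).add (Comp.const h.polyBdd_in (.num N))).congrQ fun k => by push_cast; rfl
  refine Comp.sum (v := fun k j => (if (φ k).digits ((φ k).n + N) (i k) j = true then 1 else 0) *
    2 ^ (j : ℕ)) hbc hb ?_
  have hj := Comp.counter h.polyBdd_in hb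
  have hjb : ((machineOn φ).idx fun k => (φ k).n + N).PolyBdd fun x => (x.2 : ℕ) :=
    (hb.pull Sigma.fst).of_le fun x => x.2.2.le
  have hc := fun c : ℚ => Comp.const hj.polyBdd_in (.num c)
  have hcell : ((machineOn φ).idx fun k => (φ k).n + N).CompQ
      (fun x => .pair (a x.1) (.num ((x.2 : ℕ) : ℚ)))
      fun x => ((2 * (i x.1 * ((φ x.1).n + N) + x.2) + 1 : ℕ) : ℚ) :=
    (((hc 2).mul (((hi.weaken hb).mul (hbc.weaken hb)).add hj)).add (hc 1)).congrQ
      fun x => by push_cast; rfl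
  have hcellb : ((machineOn φ).idx fun k => (φ k).n + N).PolyBdd
      fun x => 2 * (i x.1 * ((φ x.1).n + N) + x.2) + 1 := by
    refine ((PolyBdd.const 2).mul ((((hn.mul hb).pull Sigma.fst)).add hjb)).add
      (.const 1) |>.of_le fun x => ?_
    have := (i x.1).2.le
    simp only [Function.comp_apply]
    gcongr
  exact (Comp.coin hcell hcellb).mul (Comp.two_pow hj hjb)

theorem comp_sample (D N : ℕ) (h : (machineOn φ).Comp a fun k => (φ k).I.encode)
    {T : ∀ k, Finset (Fin (φ k).n)} (hT : (machineOn φ).Comp a fun k => .ofSet (T k))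
    {y : K → Data} (hy : (machineOn φ).Comp a y) :
    (machineOn φ).Comp a fun k => .ofSet ((φ k).I.sample D N (T k) ((y k).toVec (φ k).n)
      ((φ k).digits ((φ k).n + N))) := by
  have hn := polyBdd_n φ
  let φ' : (Σ k, Fin (φ k).n) → Situation d 𝓕 := fun x => φ x.1
  have hi : (machineOn φ').CompQ (fun x => .pair (a x.1) (.num ((x.2 : ℕ) : ℚ)))
      fun x => ((x.2 : ℕ) : ℚ) := Comp.counter h.polyBdd_in hn
  have h' : (machineOn φ').Comp _ fun x => (φ' x).I.encode := h.weaken hn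
  have hc := fun c : ℚ => Comp.const hi.polyBdd_in (.num c)
  have hib : (machineOn φ').PolyBdd fun x => (x.2 : ℕ) :=
    (polyBdd_n φ').of_le fun x => x.2.2.le
  have hb : (machineOn φ').CompQ (fun x => .pair (a x.1) (.num ((x.2 : ℕ) : ℚ)))
      fun x => 2 ^ ((φ' x).n + N) :=
    Comp.two_pow (((comp_n h').add (hc N)).congrQ fun x => by push_cast; rfl)
      ((polyBdd_n φ').add (.const N))
  have hth := (((hc (1 - 1 / N)).mul ((hy.weaken hn).nth hi hib).val)).mul hb
  refine comp_ofSet h (Comp.congrB (Comp.and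
    (comp_light (φ := φ') (i := fun x => x.2) D h' (hT.weaken hn) hi)
    (((comp_digits (φ := φ') (i := fun x => x.2) h' N hi).add (hc 1)).le hth)) fun x => ?_)
  simp only [Instance.sample, Finset.mem_filter, Finset.mem_univ, true_and]
  rfl

variable {m : ∀ n : ℕ, (Finset (Fin n) → ℚ) → Instance d n → ℕ}
  {out : ∀ n (f : Finset (Fin n) → ℚ) (J : Instance d n), (Fin (m n f J) → Bool) → Data}

/-- Running the given algorithm on an instance `J` computed from the input is polynomial in the
size of the input, as the length of `J` is; the oracle remains the same. -/
theorem comp_runEven {A : Prog} {p : Polynomial ℕ}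
    (hm : ∀ n f (J : Instance d n), m n f J = p.eval (inputSize f J))
    (hA : ∀ n, ∀ f ∈ 𝓕 n, ∀ J : Instance d n, RunsWithin A f J (m n f J) (out n f J))
    {J : ∀ k, Instance d (φ k).n} (hJ : (machineOn φ).Comp a fun k => (J k).encode) :
    (machineOn φ).Comp a fun k => (φ k).runEven (out (φ k).n (φ k).f) (J k) := by
  refine hJ.trans (Comp.of_exec A.useEven (u := fun k => 40 * p.eval (inputSize (φ k).f (J k)))
    ((PolyBdd.const 40).mul (PolyBdd.eval p ((hJ.polyBdd_out.add .size).of_le fun k => ?_)))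
    fun k => ?_)
  · exact Nat.add_le_add_left (Nat.le_add_left _ _) _
  · obtain ⟨t, ht, e⟩ := hA _ _ (φ k).mem (J k) fun j => (φ k).tape (2 * j)
    have e' := Exec.congr_tape (E' := ⟨fun x => (φ k).f (x.toSet (φ k).n),
      fun j => (φ k).tape (2 * j)⟩) (by rfl) e fun j hj => by
        simp [env, hj.trans_le ht]
    obtain ⟨t', ht', e''⟩ := Exec.useEven (E' := (machineOn φ).env k) (by rfl)
      (fun j => by rfl) e'
    rw [hm] at ht
    exact ⟨t', ht'.trans (Nat.mul_le_mul_left _ ht), e''⟩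

theorem comp_better {S S' : ∀ k, Finset (Fin (φ k).n)}
    (hS : (machineOn φ).Comp a fun k => .ofSet (S k))
    (hS' : (machineOn φ).Comp a fun k => .ofSet (S' k)) :
    (machineOn φ).Comp a fun k => .ofSet ((φ k).better (S k) (S' k)) :=
  (Comp.ite ((comp_value hS).le (comp_value hS')) hS' hS).congr fun k => by
    unfold Situation.better
    split_ifs <;> rfl

theorem comp_bestOf (h : (machineOn φ).Comp a fun k => (φ k).I.encode)
    {S : ∀ k, Finset (Fin (φ k).n)} (hS : (machineOn φ).Comp a fun k => .ofSet (S k))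
    {g : ∀ k, Fin (φ k).n → Finset (Fin (φ k).n)}
    (hg : (machineOn fun x : Σ k, Fin (φ k).n => φ x.1).Comp
      (fun x => .pair (a x.1) (.num ((x.2 : ℕ) : ℚ))) fun x => .ofSet (g x.1 x.2)) :
    (machineOn φ).Comp a fun k => .ofSet ((φ k).bestOf (S k) (g k) (φ k).n) := by
  have hn := polyBdd_n φ
  have hB : (machineOn φ).PolyBdd fun k => 2 + (φ k).n * 4 :=
    (PolyBdd.const 2).add (hn.mul (.const 4))
  refine Comp.forLoop (acc := fun k j => .ofSet ((φ k).bestOf (S k) (g k) j)) (comp_n h) hn hS ?_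
    hB fun k j _ => Data.size_ofSet_le _
  let φ' : (Σ k, Fin (φ k).n) → Situation d 𝓕 := fun x => φ x.1
  have hr : (machineOn φ').Comp _ _ := Comp.refl (a := fun x : Σ k, Fin (φ k).n =>
    .pair (.pair (a x.1) (.num ((x.2 : ℕ) : ℚ))) (.ofSet ((φ x.1).bestOf (S x.1) (g x.1) x.2)))
    ((((PolyBdd.const 1).add (Comp.polyBdd_idx h.polyBdd_in hn)).add
      (hB.pull Sigma.fst)).of_le fun x => by
        have := Data.size_ofSet_le ((φ x.1).bestOf (S x.1) (g x.1) x.2)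
        rw [Data.size]
        exact Nat.add_le_add_left this _)
  exact (comp_better (φ := φ') hr.snd (hr.fst.trans hg)).congr fun x => by
    simp only [Situation.bestOf, dif_pos x.2.2]
    rfl

variable {A : Prog} {p : Polynomial ℕ}

theorem comp_guess (hm : ∀ n f (J : Instance d n), m n f J = p.eval (inputSize f J))
    (hA : ∀ n, ∀ f ∈ 𝓕 n, ∀ J : Instance d n, RunsWithin A f J (m n f J) (out n f J))
    (h0 : ∀ n, ∀ f ∈ 𝓕 n, ∀ S, 0 ≤ f S) (D N : ℕ)
    (h : (machineOn φ).Comp a fun k => (φ k).I.encode)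
    {T : ∀ k, Finset (Fin (φ k).n)} (hT : (machineOn φ).Comp a fun k => .ofSet (T k)) :
    (machineOn φ).Comp a fun k => .ofSet ((φ k).guess m out h0 D N (T k)) := by
  refine Comp.cases (comp_feasible h hT) ?_ ?_
  · let φ' : {k // (φ k).I.Feasible (T k)} → Situation d 𝓕 := fun k => φ k
    have h' : (machineOn φ').Comp (a ∘ Subtype.val) fun k => (φ' k).I.encode := h.pull Subtype.val
    have hT' : (machineOn φ').Comp (a ∘ Subtype.val) fun k => .ofSet (T k) := hT.pull Subtype.val
    have hrun := comp_runEven (φ := φ') hm hA (comp_residual (φ := φ') D N h0 h' hT' fun k => k.2)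
    exact (comp_repair (φ := φ') h' (comp_sample (φ := φ') D N h' hT' hrun)).congr fun k => by
      simp only [Function.comp_apply, Situation.guess, dif_pos k.2]
      rfl
  · exact ((comp_empty h).pull _).congr fun k => by
      simp only [Function.comp_apply, Situation.guess, dif_neg k.2]

theorem comp_search (hm : ∀ n f (J : Instance d n), m n f J = p.eval (inputSize f J))
    (hA : ∀ n, ∀ f ∈ 𝓕 n, ∀ J : Instance d n, RunsWithin A f J (m n f J) (out n f J))
    (h0 : ∀ n, ∀ f ∈ 𝓕 n, ∀ S, 0 ≤ f S) (D N j : ℕ)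
    (h : (machineOn φ).Comp a fun k => (φ k).I.encode)
    {T : ∀ k, Finset (Fin (φ k).n)} (hT : (machineOn φ).Comp a fun k => .ofSet (T k)) :
    (machineOn φ).Comp a fun k => .ofSet ((φ k).search m out h0 D N j (T k)) := by
  induction j generalizing K with
  | zero => exact comp_guess hm hA h0 D N h hT
  | succ j ih =>
    have hn := polyBdd_n φ
    let φ' : (Σ k, Fin (φ k).n) → Situation d 𝓕 := fun x => φ x.1
    have h' : (machineOn φ').Comp _ fun x => (φ' x).I.encode := h.weaken hn
    exact comp_bestOf h (ih h hT) (ih (φ := φ') h' (comp_insert (φ := φ')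
      (i := fun x => x.2) h' (hT.weaken hn) (Comp.counter h.polyBdd_in hn)))

end Comp

open Machine

/-! ### The approximation guarantee -/

section Guarantee

variable {d : ℕ} {𝓕 : (n : ℕ) → Set (Finset (Fin n) → ℚ)}

/-- The positions on the tape of the bits that matter for a guess: the bits of the algorithm for the
continuous problem, and the random digits. -/
def cell {m n b : ℕ} : Fin m ⊕ (Fin n × Fin b) → ℕ
  | .inl j => 2 * j
  | .inr x => 2 * (x.1 * b + x.2) + 1

theorem cell_injective {m n b : ℕ} : Function.Injective (cell (m := m) (n := n) (b := b)) := by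
  rintro (j | ⟨i, j⟩) (j' | ⟨i', j'⟩) h <;> simp only [cell] at h
  · congr 1
    ext
    omega
  · omega
  · omega
  · have h1 : (i : ℕ) * b + j = i' * b + j' := by omega
    have hb : 0 < b := j.pos
    have h2 : (i : ℕ) = i' := by
      have := congrArg (· / b) h1
      simpa [Nat.add_comm, Nat.add_mul_div_right _ _ hb, Nat.div_eq_of_lt] using this
    have h3 : (j : ℕ) = j' := by
      rw [h2] at h1
      omega
    rw [Fin.ext h2, Fin.ext h3]

theorem cell_lt {m n b c : ℕ} (hc : 2 * m + 2 * (n * b) ≤ c) (x : Fin m ⊕ (Fin n × Fin b)) :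
    cell x < c := by
  rcases x with j | ⟨i, j⟩
  · simp only [cell]
    have := j.2
    omega
  · simp only [cell]
    have h1 : ((i : ℕ) + 1) * b ≤ n * b := Nat.mul_le_mul_right b i.2
    have h2 := j.2
    rw [add_mul] at h1
    omega

/-- The encodings of the residual instances are polynomially bounded. -/
theorem exists_residual_size_le (h0 : ∀ n, ∀ f ∈ 𝓕 n, ∀ S, 0 ≤ f S) (D N : ℕ) :
    ∃ q : Polynomial ℕ, ∀ (n : ℕ) (f) (hf : f ∈ 𝓕 n) (I : Instance d n) (T) (hT : I.Feasible T),
      inputSize f (I.residual f (h0 n f hf) D N T hT) ≤ q.eval (inputSize f I) := by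
  let φ : (Σ s : Situation d 𝓕, {T // s.I.Feasible T}) → Situation d 𝓕 := Sigma.fst
  have hb : (machineOn φ).PolyBdd fun k =>
      (Data.pair (φ k).I.encode (.ofSet k.2.1)).size :=
    (((PolyBdd.const 3).add .size).add ((polyBdd_n φ).mul (.const 4))).of_le fun k => by
      have h1 := Data.size_ofSet_le k.2.1
      have h2 : (φ k).I.encode.size ≤ (machineOn φ).size k := Nat.le_add_right _ _
      simp only [Data.size, φ] at *
      omega
  have hr := Comp.refl hb
  obtain ⟨q, hq⟩ := ((comp_residual (φ := φ) D N h0 hr.fst hr.snd fun k => k.2.2).polyBdd_out.add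
    .size)
  refine ⟨q, fun n f hf I T hT => ?_⟩
  have h1 := hq ⟨⟨n, f, hf, I, fun _ => false⟩, T, hT⟩
  exact le_trans (Nat.add_le_add_left (Nat.le_add_left _ _) _) h1

/-- The expected value of the set found for a good guess. -/
theorem le_expect_guess (hsub : ∀ n, ∀ f ∈ 𝓕 n, Submodular f)
    (h0 : ∀ n, ∀ f ∈ 𝓕 n, ∀ S, 0 ≤ f S)
    {m : ∀ n : ℕ, (Finset (Fin n) → ℚ) → Instance d n → ℕ}
    {out : ∀ n (f : Finset (Fin n) → ℚ) (J : Instance d n), (Fin (m n f J) → Bool) → Data}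
    {D N : ℕ} (hN : 0 < N) (hd : 0 < d) (hD : D = N * d * ((2 + 4 * d) * N ^ 2 + 2))
    {n : ℕ} {f : Finset (Fin n) → ℚ} (hf : f ∈ 𝓕 n) {I : Instance d n} {T : Finset (Fin n)}
    (hT : I.Feasible T) (hTpos : 0 < f T) {J : Instance d n}
    (hJ : J = I.residual f (h0 n f hf) D N T hT)
    (hout : ∀ ω, J.FracFeasible ((out n f J ω).toVec n)) {c : ℕ}
    (hc : 2 * m n f J + 2 * (n * (n + N)) ≤ c) :
    (1 - 1 / N) * expect (fun ω => multilinear f ((out n f J ω).toVec n)) - 2 / N * I.opt f ≤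
      expect fun ω : Fin c → Bool =>
        f (Situation.guess m out h0 D N ⟨n, f, hf, I, (env f ω).tape⟩ T) := by
  let G : (Fin (m n f J) → Bool) × (Fin n → Fin (n + N) → Bool) → ℚ := fun u =>
    f (I.repair (I.sample D N T ((out n f J u.1).toVec n) u.2))
  let e : (Fin (m n f J) ⊕ (Fin n × Fin (n + N)) → Bool) ≃
      (Fin (m n f J) → Bool) × (Fin n → Fin (n + N) → Bool) :=
    (Equiv.sumArrowEquivProdArrow _ _ _).trans
      ((Equiv.refl _).prodCongr (Equiv.curry _ _ _))
  let ψ : Fin (m n f J) ⊕ (Fin n × Fin (n + N)) → Fin c := fun x => ⟨cell x, cell_lt hc x⟩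
  have hψ : Function.Injective ψ := fun x x' h => cell_injective (Fin.mk.inj_iff.1 h)
  have hG : ∀ ω : Fin c → Bool,
      f (Situation.guess m out h0 D N ⟨n, f, hf, I, (env f ω).tape⟩ T) = G (e (ω ∘ ψ)) := by
    intro ω
    have htape : ∀ x, (env f ω).tape (cell x) = ω (ψ x) := fun x => by
      simp [env, ψ, cell_lt hc x]
    have h1 : (fun j : Fin (m n f J) => (env f ω).tape (2 * j)) = (e (ω ∘ ψ)).1 :=
      funext fun j => htape (.inl j)
    have h2 : (fun (i : Fin n) (j : Fin (n + N)) =>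
        (env f ω).tape (2 * (i * (n + N) + j) + 1)) = (e (ω ∘ ψ)).2 :=
      funext fun i => funext fun j => htape (.inr (i, j))
    simp only [Situation.guess, dif_pos hT, ← hJ, G, ← h1, ← h2]
    rfl
  rw [expect_eq_average, expect_eq_average, funext hG,
    average_comp_injective hψ fun η => G (e η), average_equiv e G, average_prod,
    ← average_mul_sub]
  refine average_mono fun ω => ?_
  simp only [G]
  have hy := hout ω
  rw [I.average_sample hN T hy.1 fun R => f (I.repair R)]
  subst hJ
  exact Instance.le_multilinear_repair_roundProb (hsub n f hf) (h0 n f hf) hN hd hD hT hTpos hy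

end Guarantee

theorem HasContinuousApprox.hasDiscreteApprox {d : ℕ} (hd : 1 ≤ d)
    {𝓕 : (n : ℕ) → Set (Finset (Fin n) → ℚ)}
    (h𝓕 : ∀ n, ∀ f ∈ 𝓕 n, Submodular f ∧ ∀ S, 0 ≤ f S)
    {α : ℝ} (hα : 0 < α) (hα1 : α ≤ 1) (hA : HasContinuousApprox d 𝓕 α) {ε : ℝ} (hε : 0 < ε) :
    HasDiscreteApprox d 𝓕 (α - ε) := by
  have hsub : ∀ n, ∀ f ∈ 𝓕 n, Submodular f := fun n f hf => (h𝓕 n f hf).1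
  have h0 : ∀ n, ∀ f ∈ 𝓕 n, ∀ S, 0 ≤ f S := fun n f hf => (h𝓕 n f hf).2
  obtain ⟨A, p, hA⟩ := hA
  have : Nonempty Data := ⟨.num 0⟩
  choose! out hrun hfrac hval using hA
  -- The total loss will be `4 / N` times the optimum.
  obtain ⟨N, hNε⟩ := exists_nat_gt (4 / ε)
  have hNr : (0 : ℝ) < N := (by positivity : (0 : ℝ) < 4 / ε).trans hNε
  have hN : 0 < N := by exact_mod_cast hNr
  obtain ⟨D, hD⟩ : ∃ D, D = N * d * ((2 + 4 * d) * N ^ 2 + 2) := ⟨_, rfl⟩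
  have hD0 : 0 < D := by rw [hD]; positivity
  let m : ∀ n : ℕ, (Finset (Fin n) → ℚ) → Instance d n → ℕ := fun n f J => p.eval (inputSize f J)
  -- The algorithm tries all guesses of the size that a good guess may have.
  have henc : (machineOn (fun s : Situation d 𝓕 => s)).PolyBdd fun s => s.I.encode.size :=
    PolyBdd.size.of_le fun s => Nat.le_add_right _ _
  have hB := Comp.refl henc
  obtain ⟨B, pB, hB⟩ := comp_search (m := m) (out := out) (fun _ _ _ => rfl) hrun h0 D N
    (d * D * N + 1) hB (comp_empty hB)
  obtain ⟨q, hq⟩ := exists_residual_size_le (d := d) h0 D N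
  refine ⟨B, pB + (2 * p.comp q + 2 * (.X * (.X + .C N))), fun n f hf I => ?_⟩
  -- Besides the running time, the number `c` of random bits exceeds all positions used by a guess.
  set c := (pB + (2 * p.comp q + 2 * (.X * (.X + .C N)))).eval (inputSize f I) with hc
  let sit : (Fin c → Bool) → Situation d 𝓕 := fun ω => ⟨n, f, hf, I, (env f ω).tape⟩
  let best : (Fin c → Bool) → Finset (Fin n) := fun ω =>
    (sit ω).search m out h0 D N (d * D * N + 1) ∅
  have hbest : ∀ ω, I.Feasible (best ω) := fun ω =>
    Situation.feasible_search (s := sit ω) m out h0 D N _ _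
  refine ⟨fun ω => .ofSet (best ω), fun ω => ?_, fun ω => ?_, ?_⟩
  · obtain ⟨t, ht, e⟩ := hB (sit ω)
    refine ⟨t, ht.trans ?_, e⟩
    rw [hc, Polynomial.eval_add]
    exact Nat.le_add_right _ _
  · rw [Data.toSet_ofSet]
    exact hbest ω
  simp only [Data.toSet_ofSet]
  have hO : 0 ≤ I.opt f := (h0 n f hf ∅).trans (I.le_opt f I.feasible_empty)
  rcases hO.eq_or_lt with hO | hO
  · rw [← hO, Rat.cast_zero, mul_zero, Rat.cast_nonneg, expect]
    exact div_nonneg (Finset.sum_nonneg fun ω _ => h0 n f hf _) (by positivity)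
  obtain ⟨T, S, hTcard, hTpos, hTS, hS, hl, hSval⟩ :=
    Instance.exists_light (hsub n f hf) (h0 n f hf) hN (Nat.mul_pos hd hD0) hO
  have hT : I.Feasible T := hS.mono hTS
  obtain ⟨J, hJ⟩ : ∃ J, J = I.residual f (h0 n f hf) D N T hT := ⟨_, rfl⟩
  have hJopt : (1 - 1 / N) * I.opt f ≤ J.opt f := by
    rw [hJ]
    exact hSval.trans (Instance.le_residual_opt (h0 n f hf) hT hTS hS hl)
  have hcell : 2 * m n f J + 2 * (n * (n + N)) ≤ c := by
    have h1 : m n f J ≤ p.eval (q.eval (inputSize f I)) := eval_mono p (hJ ▸ hq n f hf I T hT)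
    have h2 := n_le_inputSize f I
    have h3 : n * (n + N) ≤ inputSize f I * (inputSize f I + N) := by gcongr
    simp only [hc, Polynomial.eval_add, Polynomial.eval_mul, Polynomial.eval_comp,
      Polynomial.eval_X, Polynomial.eval_C, Polynomial.eval_ofNat]
    omega
  have h1 := le_expect_guess (m := m) (out := out) hsub h0 hN hd hD hf hT hTpos hJ
    (hfrac n f hf J) hcell
  have h2 : expect (fun ω : Fin c → Bool => f (Situation.guess m out h0 D N (sit ω) T)) ≤
      expect fun ω => f (best ω) := by
    rw [expect_eq_average, expect_eq_average]
    refine average_mono fun ω => ?_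
    have := Situation.guess_le_search (s := sit ω) m out h0 D N (d * D * N + 1) ∅ T hTcard
    rwa [Finset.empty_union] at this
  have h3 := h1.trans h2
  have h4 := hval n f hf J
  set F := expect fun ω => multilinear f ((out n f J ω).toVec n)
  have h5 : (1 - 1 / N) * (F : ℝ) - 2 / N * (I.opt f : ℝ) ≤
      ((expect fun ω => f (best ω) : ℚ) : ℝ) := by
    have := (Rat.cast_le (K := ℝ)).2 h3
    push_cast at this
    exact this
  have h6 : (1 - 1 / N) * (I.opt f : ℝ) ≤ (J.opt f : ℝ) := by
    have := (Rat.cast_le (K := ℝ)).2 hJopt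
    push_cast at this
    exact this
  have hOr : (0 : ℝ) < I.opt f := by exact_mod_cast hO
  have he0 : (0 : ℝ) < 1 / N := by positivity
  have he1 : (0 : ℝ) ≤ 1 - 1 / N := by
    have := (Rat.cast_nonneg (K := ℝ)).2 (Instance.one_sub_inv_nonneg hN)
    push_cast at this
    exact this
  have he4 : 4 * (1 / N : ℝ) ≤ ε := by
    rw [div_lt_iff₀ hε] at hNε
    rw [mul_one_div, div_le_iff₀ hNr]
    linarith
  have h7 : (2 / N : ℝ) = 2 * (1 / N) := by ring
  rw [h7] at h5
  set e : ℝ := 1 / N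
  refine le_trans ?_ h5
  have h8 : (1 - e) * (α * ((1 - e) * I.opt f)) ≤ (1 - e) * F :=
    mul_le_mul_of_nonneg_left ((mul_le_mul_of_nonneg_left h6 hα.le).trans h4) he1
  have h9 : (α - ε) * (I.opt f : ℝ) ≤ ((1 - e) * (α * (1 - e)) - 2 * e) * I.opt f := by
    refine mul_le_mul_of_nonneg_right ?_ hOr.le
    nlinarith [mul_nonneg hα.le (sq_nonneg e), mul_le_mul_of_nonneg_right hα1 he0.le]
  linarith

end SubKnapsack

theorem mainTheorem1 (d : ℕ) (hd : 1 ≤ d)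
    (𝓕 : (n : ℕ) → Set (Finset (Fin n) → ℚ))
    (h𝓕 : ∀ n, ∀ f ∈ 𝓕 n, SubKnapsack.Submodular f ∧ ∀ S, 0 ≤ f S)
    (α : ℝ) (hα : 0 < α) (hα1 : α ≤ 1)
    (hA : SubKnapsack.HasContinuousApprox d 𝓕 α) :
    ∀ ε : ℝ, 0 < ε → SubKnapsack.HasDiscreteApprox d 𝓕 (α - ε) :=
  fun _ hε => hA.hasDiscreteApprox hd h𝓕 hα hα1 hε
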